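/- **Theorem A1.** Throughout, "of class $C^r$" means smooth ($r=\infty$) or real-analytic ($r=\omega$); the statement holds in each of the two categories. Let $(M,\sigma)$ be a symplectic manifold of dimension $2n$ of class $C^r$ (that is, $\sigma$ is a closed nondegenerate differential $2$-form), let $p\in M$, and let $S_1,S_2\subset M$ be germs at $p$ of $1$-dimensional submanifolds of class $C^r$, both passing through $p$, so that $N=S_1\cup S_2$ is the germ of an immersed curve at a double point $p$. Assume * (G2) $T_pS_1\cap T_pS_2=\{0\}$; * (G3) the restriction of $\sigma$ to the space $T_pS_1+T_pS_2$ has the maximal possible rank $2$. Let $(M',\sigma')$, $p'\in M'$ and $N'=S_1'\cup S_2'$ be further data of the same kind (same $n$, same category), also satisfying (G2) and (G3). Then the germs $(M,\sigma,N)_p$ and $(M',\sigma',N')_{p'}$ are equivalent: there is a local diffeomorphism $\Phi:(M,p)\to(M',p')$ of class $C^r$ such that $\Phi^*\sigma'=\sigma$ near $p$ and $\Phi(N)=N'$ as germs at $p'$. -/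

import Mathlib

open scoped Manifold ContDiff Topology

/-- The expression of a field `σ` of alternating 2-forms in a chart `φ`: the pull-back of `σ` under
`φ.symm`, a 2-form on the open subset `φ.target` of the model space. -/
noncomputable def formInChart {n : ℕ} {M : Type*} [TopologicalSpace M]
    [ChartedSpace (EuclideanSpace ℝ (Fin (2 * n))) M]
    (σ : ∀ q : M, TangentSpace (𝓡 (2 * n)) q [⋀^Fin 2]→L[ℝ] ℝ)
    (φ : OpenPartialHomeomorph M (EuclideanSpace ℝ (Fin (2 * n))))
    (y : EuclideanSpace ℝ (Fin (2 * n))) : EuclideanSpace ℝ (Fin (2 * n)) [⋀^Fin 2]→L[ℝ] ℝ :=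
  (σ (φ.symm y)).compContinuousLinearMap (mfderiv (𝓡 (2 * n)) (𝓡 (2 * n)) φ.symm y)

/-- A symplectic form of class `C^r` on a `2n`-dimensional manifold `M`: a closed nondegenerate
differential 2-form. Regularity and closedness are expressed in the charts of the atlas
(`r = ∞`: smooth; `r = ω`: real-analytic). -/
structure SymplecticForm (r : WithTop ℕ∞) (n : ℕ) (M : Type*) [TopologicalSpace M]
    [ChartedSpace (EuclideanSpace ℝ (Fin (2 * n))) M] where
  /-- the alternating form on each tangent space -/
  form : ∀ q : M, TangentSpace (𝓡 (2 * n)) q [⋀^Fin 2]→L[ℝ] ℝ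
  contDiffOn : ∀ φ ∈ atlas (EuclideanSpace ℝ (Fin (2 * n))) M,
    ContDiffOn ℝ r (formInChart form φ) φ.target
  closed : ∀ φ ∈ atlas (EuclideanSpace ℝ (Fin (2 * n))) M,
    ∀ y ∈ φ.target, extDeriv (formInChart form φ) y = 0
  nondegenerate : ∀ (q : M) (v : TangentSpace (𝓡 (2 * n)) q),
    (∀ w : TangentSpace (𝓡 (2 * n)) q, form q ![v, w] = 0) → v = 0

/-- Near `p`, the set `S` is an (embedded) `k`-dimensional submanifold of class `C^r` through `p`:
in some chart of the maximal `C^r` atlas around `p` it is a `k`-dimensional affine slice. -/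
def IsSubmanifoldAt (r : WithTop ℕ∞) (n : ℕ) {M : Type*} [TopologicalSpace M]
    [ChartedSpace (EuclideanSpace ℝ (Fin (2 * n))) M] (k : ℕ) (S : Set M) (p : M) : Prop :=
  ∃ φ ∈ IsManifold.maximalAtlas (𝓡 (2 * n)) r M, p ∈ φ.source ∧
    ∃ W : Submodule ℝ (EuclideanSpace ℝ (Fin (2 * n))), Module.finrank ℝ W = k ∧
      ∀ q ∈ φ.source, q ∈ S ↔ φ q - φ p ∈ W

/-- The tangent space `T_p S`, spanned by the velocities at `p` of the `C^1` curves in `S`. -/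
noncomputable def tangentSpaceOf (n : ℕ) {M : Type*} [TopologicalSpace M]
    [ChartedSpace (EuclideanSpace ℝ (Fin (2 * n))) M] (S : Set M) (p : M) :
    Submodule ℝ (TangentSpace (𝓡 (2 * n)) p) :=
  Submodule.span ℝ {v : TangentSpace (𝓡 (2 * n)) p |
    ∃ γ : ℝ → M, γ 0 = p ∧ ContMDiffAt 𝓘(ℝ, ℝ) (𝓡 (2 * n)) 1 γ 0 ∧
      (∀ᶠ t in 𝓝 (0 : ℝ), γ t ∈ S) ∧ mfderiv 𝓘(ℝ, ℝ) (𝓡 (2 * n)) γ 0 (1 : ℝ) = v}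

/-- An alternating 2-form on a vector space, as a bilinear form. -/
def bilinOfForm {V : Type*} [AddCommGroup V] [Module ℝ V] [TopologicalSpace V]
    (s : V [⋀^Fin 2]→L[ℝ] ℝ) : LinearMap.BilinForm ℝ V :=
  LinearMap.mk₂ ℝ (fun v w => s ![v, w])
    (fun v v' w => s.toAlternatingMap.map_vecCons_add ![w] v v')
    (fun c v w => s.toAlternatingMap.map_vecCons_smul ![w] c v)
    (fun v w w' => by
      have hu : ∀ x : V, Function.update ![v, w] 1 x = ![v, x] := fun x => by
        ext i; fin_cases i <;> rfl
      have h := s.map_update_add ![v, w] 1 w w'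
      simpa only [hu] using h)
    (fun c v w => by
      have hu : ∀ x : V, Function.update ![v, w] 1 x = ![v, x] := fun x => by
        ext i; fin_cases i <;> rfl
      have h := s.map_update_smul ![v, w] 1 c w
      simpa only [hu] using h)

/-- The rank of the restriction to the subspace `W` of an alternating 2-form. -/
noncomputable def rankOn {V : Type*} [AddCommGroup V] [Module ℝ V] [TopologicalSpace V]
    (s : V [⋀^Fin 2]→L[ℝ] ℝ) (W : Submodule ℝ V) : ℕ :=
  Module.finrank ℝ (LinearMap.range ((bilinOfForm s).restrict W))

/-- Condition (G2) for a couple of `k`-dimensional strata: the couple is regular at `p`. -/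
def CondG2 (n : ℕ) {M : Type*} [TopologicalSpace M]
    [ChartedSpace (EuclideanSpace ℝ (Fin (2 * n))) M] (k : ℕ) (S₁ S₂ : Set M) (p : M) : Prop :=
  (k ≤ n → tangentSpaceOf n S₁ p ⊓ tangentSpaceOf n S₂ p = ⊥) ∧
  (n < k → tangentSpaceOf n S₁ p ⊔ tangentSpaceOf n S₂ p = ⊤)

/-- Condition (G3) for a couple of `k`-dimensional strata: the form `σ` has the maximal possible
rank on `T_p S₁ + T_p S₂` (if `k ≤ n`), respectively on `T_p S₁ ∩ T_p S₂` (if `k > n`). -/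
def CondG3 {r : WithTop ℕ∞} {n : ℕ} {M : Type*} [TopologicalSpace M]
    [ChartedSpace (EuclideanSpace ℝ (Fin (2 * n))) M] (σ : SymplecticForm r n M)
    (k : ℕ) (S₁ S₂ : Set M) (p : M) : Prop :=
  (k ≤ n → rankOn (σ.form p) (tangentSpaceOf n S₁ p ⊔ tangentSpaceOf n S₂ p) = 2 * k) ∧
  (n < k → rankOn (σ.form p) (tangentSpaceOf n S₁ p ⊓ tangentSpaceOf n S₂ p) = 2 * (k - n))

/-- Equivalence of the germs `(M, σ, N)_p` and `(M', σ', N')_{p'}`: there is a local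
diffeomorphism of class `C^r` that takes `p` to `p'`, pulls `σ'` back to `σ` and maps `N` onto `N'`
near these points. -/
def GermEquivalent {r : WithTop ℕ∞} {n : ℕ}
    {M : Type*} [TopologicalSpace M] [ChartedSpace (EuclideanSpace ℝ (Fin (2 * n))) M]
    {M' : Type*} [TopologicalSpace M'] [ChartedSpace (EuclideanSpace ℝ (Fin (2 * n))) M']
    (σ : SymplecticForm r n M) (N : Set M) (p : M)
    (σ' : SymplecticForm r n M') (N' : Set M') (p' : M') : Prop :=
  ∃ Φ : OpenPartialHomeomorph M M',
    ContMDiffOn (𝓡 (2 * n)) (𝓡 (2 * n)) r Φ Φ.source ∧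
    ContMDiffOn (𝓡 (2 * n)) (𝓡 (2 * n)) r Φ.symm Φ.target ∧
    p ∈ Φ.source ∧ Φ p = p' ∧
    (∀ q ∈ Φ.source, (σ'.form (Φ q)).compContinuousLinearMap
      (mfderiv (𝓡 (2 * n)) (𝓡 (2 * n)) Φ q) = σ.form q) ∧
    Φ '' (N ∩ Φ.source) = N' ∩ Φ.target

-- In charts at the two points the data become closed 2-forms on open sets of a vector space, with
-- two curves of velocities u, v at the base point. Condition (G3) gives β(u, v) ≠ 0: otherwise the
-- form would vanish on the sum of the tangent lines (`exists_isSymplecticCross`). Each pair of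
-- curves is straightened to the lines ℝu and ℝv by a local diffeomorphism with identity
-- differential at 0 (`exists_straightening`). Once v and v' are rescaled, (u, v) and (u', v') are
-- hyperbolic pairs, so a linear symplectic isomorphism carries one to the other
-- (`exists_symplectic_equiv`). What remains is two closed forms b, c with b 0 = c 0 and a single
-- pair of lines. A local diffeomorphism is wanted that pulls c back to b and fixes the points of
-- the lines.
--
-- This is Moser's method (`exists_moser`). The difference θ = c - b has a primitive α that
-- vanishes, as a covector, at each point of the two lines, and whose derivative vanishes at 0; it
-- is the radial primitive corrected by an exact form (`exists_primitive_vanishing_on_lines`). The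
-- field X_t with (b + tθ)(X_t, ·) = -α is then zero on the lines, and the time-one map of its flow
-- is the required diffeomorphism, by `moser_identity`.
--
-- The smooth and the analytic case are treated together. The flow is obtained from the inverse
-- function theorem in the Banach space C([0, 1], E), applied to γ ↦ γ - ∫ X_t(γ) (`exists_flow`).
-- Regularity in the initial point thus reduces to regularity of the superposition operators γ ↦ f ∘
-- γ (`exists_contDiffOn_superposition`), which also give regularity of the radial primitive.

universe u v

set_option linter.unusedSectionVars false
set_option linter.unusedVariables false
set_option maxSynthPendingDepth 3

/-! ### Superposition operators on spaces of continuous maps -/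

section Superposition

variable {K : Type*} [TopologicalSpace K] [CompactSpace K]
  {E F : Type*} [NormedAddCommGroup E] [NormedSpace ℝ E]
  [NormedAddCommGroup F] [NormedSpace ℝ F]

open Classical in
/-- The superposition operator `γ ↦ f ∘ γ` on continuous maps (`0` where `f ∘ γ` is not
continuous). -/
noncomputable def superposition (K : Type*) [TopologicalSpace K] (f : E → F) (γ : C(K, E)) :
    C(K, F) :=
  if h : Continuous (f ∘ γ) then ⟨f ∘ γ, h⟩ else 0

theorem superposition_apply {f : E → F} {U : Set E} (hf : ContinuousOn f U) {γ : C(K, E)}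
    (hγ : ∀ t, γ t ∈ U) (t : K) : superposition K f γ t = f (γ t) := by
  have h : Continuous (f ∘ γ) := hf.comp_continuous γ.continuous hγ
  simp [superposition, h]

/-- The pointwise application of a continuous multilinear map to continuous maps. -/
noncomputable def multilinearPointwise (K : Type*) [TopologicalSpace K] [CompactSpace K] {n : ℕ}
    (p : ContinuousMultilinearMap ℝ (fun _ : Fin n => E) F) :
    ContinuousMultilinearMap ℝ (fun _ : Fin n => C(K, E)) C(K, F) :=
  MultilinearMap.mkContinuous
    { toFun := fun h => ⟨fun t => p fun i => h i t, by fun_prop⟩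
      map_update_add' := fun m i x y => by
        ext t
        have h : ∀ z : C(K, E), (fun j => Function.update m i z j t)
            = Function.update (fun j => m j t) i (z t) := fun z => by
          ext j; by_cases hj : j = i
          · subst hj; simp
          · simp [hj]
        simp [h]
      map_update_smul' := fun m i c x => by
        ext t
        have h : ∀ z : C(K, E), (fun j => Function.update m i z j t)
            = Function.update (fun j => m j t) i (z t) := fun z => by
          ext j; by_cases hj : j = i
          · subst hj; simp
          · simp [hj]
        simp [h] } ‖p‖ (fun m => by
      refine (ContinuousMap.norm_le _ (by positivity)).2 fun t => ?_
      refine (p.le_opNorm _).trans ?_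
      gcongr with i
      exact (m i).norm_coe_le_norm t)

theorem norm_multilinearPointwise_le {n : ℕ}
    (p : ContinuousMultilinearMap ℝ (fun _ : Fin n => E) F) :
    ‖multilinearPointwise K p‖ ≤ ‖p‖ :=
  MultilinearMap.mkContinuous_norm_le _ (norm_nonneg _) _

/-- The coefficients act pointwise and their norms do not grow, so the series converges in the sup
norm on a ball of the same radius. Evaluation at each point of `K` then identifies its sum. -/
theorem HasFPowerSeriesOnBall.superposition [CompleteSpace F] {f : E → F}
    {p : FormalMultilinearSeries ℝ E F} {c : E} {R : ENNReal}
    (hf : HasFPowerSeriesOnBall f p c R) (hc : ContinuousOn f (Metric.eball c R)) :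
    HasFPowerSeriesOnBall (superposition K f) (fun n => multilinearPointwise K (p n))
      (ContinuousMap.const K c) R where
  r_le := hf.r_le.trans <| by
    refine ENNReal.le_of_forall_nnreal_lt fun r hr => ?_
    obtain ⟨C, -, hC⟩ := p.norm_mul_pow_le_of_lt_radius hr
    refine FormalMultilinearSeries.le_radius_of_bound _ C fun n => ?_
    refine le_trans ?_ (hC n)
    gcongr
    exact norm_multilinearPointwise_le _
  r_pos := hf.r_pos
  hasSum := by
    intro y hy
    have hy' : (‖y‖₊ : ENNReal) < R := by
      rwa [Metric.mem_eball, edist_zero_right, enorm_eq_nnnorm] at hy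
    have hyt : ∀ t, y t ∈ Metric.eball (0 : E) R := fun t => by
      rw [Metric.mem_eball, edist_zero_right]
      refine lt_of_le_of_lt ?_ hy'
      rw [enorm_eq_nnnorm]
      exact_mod_cast y.norm_coe_le_norm t
    have hsum : Summable fun n => (multilinearPointwise K (p n)) fun _ : Fin n => y := by
      have h1 := p.summable_norm_mul_pow (lt_of_lt_of_le hy' hf.r_le)
      refine Summable.of_norm_bounded h1 fun n => ?_
      refine ((multilinearPointwise K (p n)).le_opNorm _).trans ?_
      simp only [Finset.prod_const, Finset.card_univ, Fintype.card_fin, coe_nnnorm]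
      gcongr
      exact norm_multilinearPointwise_le _
    suffices h : _root_.superposition K f (ContinuousMap.const K c + y) =
        ∑' n, (multilinearPointwise K (p n)) fun _ : Fin n => y by
      rw [h]; exact hsum.hasSum
    ext t
    have hct : ∀ t, (ContinuousMap.const K c + y) t ∈ Metric.eball c R := fun t => by
      have := hyt t
      simpa [Metric.mem_eball, edist_zero_right, edist_eq_enorm_sub] using this
    rw [superposition_apply hc hct]
    have h2 := (ContinuousMap.evalCLM ℝ t : C(K, F) →L[ℝ] F).hasSum hsum.hasSum
    have h3 := hf.hasSum (hyt t)
    exact h3.unique h2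

/-- Compactness of the range of `γ` makes `δ` independent of `t`, although `E` need not be locally
compact. -/
theorem exists_uniform_modulus_near_path {f : E → F} {U : Set E} (hU : IsOpen U)
    (hf : ContinuousOn f U) {γ : C(K, E)} (hγ : ∀ t, γ t ∈ U) {ε : ℝ} (hε : 0 < ε) :
    ∃ δ > 0, ∀ t y, ‖y - γ t‖ < δ → y ∈ U ∧ ‖f y - f (γ t)‖ < ε := by
  have hK : IsCompact (Set.range γ) := isCompact_range γ.continuous
  have h1 := hK.uniformContinuousAt_of_continuousAt (r := {q : F × F | dist q.1 q.2 < ε}) f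
    (by rintro _ ⟨t, rfl⟩; exact hf.continuousAt (hU.mem_nhds (hγ t)))
    (Metric.dist_mem_uniformity hε)
  obtain ⟨δ₁, hδ₁, h1⟩ := Metric.mem_uniformity_dist.1 h1
  obtain ⟨δ₂, hδ₂, h2⟩ := hK.exists_thickening_subset_open hU (by rintro _ ⟨t, rfl⟩; exact hγ t)
  refine ⟨min δ₁ δ₂, lt_min hδ₁ hδ₂, fun t y hy => ⟨h2 ?_, ?_⟩⟩
  · rw [Metric.mem_thickening_iff]
    exact ⟨γ t, ⟨t, rfl⟩, by rw [dist_eq_norm]; exact hy.trans_le (min_le_right _ _)⟩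
  · have := h1 (a := γ t) (b := y)
      (by rw [dist_comm, dist_eq_norm]; exact hy.trans_le (min_le_left _ _)) ⟨t, rfl⟩
    rw [← dist_eq_norm, dist_comm]; exact this

/-- The open set of continuous maps with values in `U`. -/
def mapsInto (K : Type*) [TopologicalSpace K] (U : Set E) : Set C(K, E) := {γ | ∀ t, γ t ∈ U}

theorem isOpen_mapsInto {U : Set E} (hU : IsOpen U) : IsOpen (mapsInto K U) := by
  have := ContinuousMap.isOpen_setOfPred_mapsTo (X := K) (Y := E) isCompact_univ hU
  convert this using 1
  ext γ; simp [mapsInto, Set.MapsTo]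

theorem continuousOn_superposition {f : E → F} {U : Set E} (hU : IsOpen U)
    (hf : ContinuousOn f U) : ContinuousOn (superposition K f) (mapsInto K U) := by
  intro γ hγ
  refine ContinuousAt.continuousWithinAt ?_
  rw [Metric.continuousAt_iff]
  intro ε hε
  obtain ⟨δ, hδ, h⟩ := exists_uniform_modulus_near_path hU hf hγ (half_pos hε)
  refine ⟨δ, hδ, fun η hη => ?_⟩
  have hηt : ∀ t, ‖η t - γ t‖ < δ := fun t => by
    rw [← dist_eq_norm]; exact (ContinuousMap.dist_apply_le_dist t).trans_lt hη
  refine lt_of_le_of_lt ((ContinuousMap.dist_le (half_pos hε).le).2 fun t => ?_) (half_lt_self hε)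
  rw [superposition_apply hf (fun t => (h t _ (hηt t)).1), superposition_apply hf hγ, dist_eq_norm]
  exact (h t _ (hηt t)).2.le

/-- Pointwise application of a continuous family of continuous linear maps. -/
noncomputable def applyPointwise (K : Type*) [TopologicalSpace K] [CompactSpace K] (E F : Type*)
    [NormedAddCommGroup E] [NormedSpace ℝ E] [NormedAddCommGroup F] [NormedSpace ℝ F] :
    C(K, E →L[ℝ] F) →L[ℝ] C(K, E) →L[ℝ] C(K, F) :=
  LinearMap.mkContinuous₂
    (LinearMap.mk₂ ℝ (fun (a : C(K, E →L[ℝ] F)) (h : C(K, E)) =>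
        (⟨fun t => a t (h t), by fun_prop⟩ : C(K, F)))
      (fun a b h => by ext t; simp) (fun c a h => by ext t; simp)
      (fun a h k => by ext t; simp) (fun c a h => by ext t; simp)) 1 (fun a h => by
      refine (ContinuousMap.norm_le _ (by positivity)).2 fun t => ?_
      refine ((a t).le_opNorm _).trans ?_
      rw [one_mul]
      gcongr
      · exact a.norm_coe_le_norm t
      · exact h.norm_coe_le_norm t)

theorem applyPointwise_apply (a : C(K, E →L[ℝ] F)) (h : C(K, E)) (t : K) :
    applyPointwise K E F a h t = a t (h t) := rfl

/-- The mean value inequality on the balls around the points `γ t` bounds the remainder. The modulus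
of continuity of the derivative along `γ` is uniform in `t`, so the bound holds in the sup norm. -/
theorem hasFDerivAt_superposition {f : E → F} {U : Set E} (hU : IsOpen U)
    (hf : ContDiffOn ℝ 1 f U) {γ : C(K, E)} (hγ : γ ∈ mapsInto K U) :
    HasFDerivAt (superposition K f) (applyPointwise K E F (superposition K (fderiv ℝ f) γ)) γ := by
  have hDf : ContinuousOn (fderiv ℝ f) U := hf.continuousOn_fderiv_of_isOpen hU le_rfl
  rw [hasFDerivAt_iff_isLittleO_nhds_zero, Asymptotics.isLittleO_iff]
  intro ε hε
  obtain ⟨δ, hδ, h⟩ := exists_uniform_modulus_near_path hU hDf hγ hε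
  filter_upwards [Metric.ball_mem_nhds (0 : C(K, E)) hδ] with k hk
  have hkδ : ‖k‖ < δ := by simpa using hk
  have hkt : ∀ t, ‖k t‖ < δ := fun t => (k.norm_coe_le_norm t).trans_lt hkδ
  refine (ContinuousMap.norm_le _ (by positivity)).2 fun t => ?_
  have hmem : ∀ t, (γ + k) t ∈ U := fun t => (h t _ (by simpa using hkt t)).1
  simp only [ContinuousMap.sub_apply, applyPointwise_apply]
  rw [superposition_apply hf.continuousOn hmem, superposition_apply hf.continuousOn hγ,
    superposition_apply hDf hγ]
  have h4 := (convex_ball (γ t) δ).norm_image_sub_le_of_norm_hasFDerivWithin_le' (𝕜 := ℝ)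
    (f := f) (f' := fderiv ℝ f) (φ := fderiv ℝ f (γ t)) (C := ε) (x := γ t) (y := γ t + k t)
    (fun y hy => ((hf.differentiableOn one_ne_zero).differentiableAt
      (hU.mem_nhds (h t y (by simpa [dist_eq_norm] using hy)).1)).hasFDerivAt.hasFDerivWithinAt)
    (fun y hy => (h t y (by simpa [dist_eq_norm] using hy)).2.le)
    (Metric.mem_ball_self hδ) (by simpa using hkt t)
  refine le_trans (by simpa using h4) ?_
  gcongr
  exact k.norm_coe_le_norm t

end Superposition

/-- The derivative is again a superposition operator, that of `fderiv ℝ f`, followed by a continuous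
linear map, so induction applies. The target becomes `E →L[ℝ] F`, hence the quantification over `F`
and the common universe. -/
theorem contDiffOn_superposition_nat {K : Type*} [TopologicalSpace K] [CompactSpace K]
    {E : Type u} [NormedAddCommGroup E] [NormedSpace ℝ E] {U : Set E} (hU : IsOpen U) (k : ℕ) :
    ∀ {F : Type u} [NormedAddCommGroup F] [NormedSpace ℝ F] {f : E → F},
      ContDiffOn ℝ k f U → ContDiffOn ℝ k (superposition K f) (mapsInto K U) := by
  induction k with
  | zero =>
    intro F _ _ f hf
    exact contDiffOn_zero.2 (continuousOn_superposition hU hf.continuousOn)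
  | succ k ih =>
    intro F _ _ f hf
    have hf1 : ContDiffOn ℝ 1 f U := hf.of_le (by norm_cast; omega)
    have hd : ∀ γ ∈ mapsInto K U, HasFDerivAt (superposition K f)
        (applyPointwise K E F (superposition K (fderiv ℝ f) γ)) γ := fun γ hγ =>
      hasFDerivAt_superposition hU hf1 hγ
    push_cast at hf ⊢
    rw [contDiffOn_succ_iff_fderiv_of_isOpen hU] at hf
    rw [contDiffOn_succ_iff_fderiv_of_isOpen (isOpen_mapsInto hU)]
    refine ⟨fun γ hγ => (hd γ hγ).differentiableAt.differentiableWithinAt, by simp, ?_⟩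
    have h2 := (applyPointwise K E F).contDiff.comp_contDiffOn (ih hf.2.2)
    exact h2.congr fun γ hγ => (hd γ hγ).fderiv

/-- The superposition operator of a smooth (or analytic) map is smooth (or analytic) near
constant maps. -/
theorem exists_contDiffOn_superposition (K : Type*) [TopologicalSpace K] [CompactSpace K]
    {E F : Type u} [NormedAddCommGroup E] [NormedSpace ℝ E] [NormedAddCommGroup F]
    [NormedSpace ℝ F] [CompleteSpace F] {r : WithTop ℕ∞} (hr : r = ∞ ∨ r = ω) {U : Set E}
    (hU : IsOpen U) {f : E → F} (hf : ContDiffOn ℝ r f U) {c : E} (hc : c ∈ U) :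
    ∃ V : Set C(K, E), IsOpen V ∧ ContinuousMap.const K c ∈ V ∧ V ⊆ mapsInto K U ∧
      ContDiffOn ℝ r (superposition K f) V := by
  rcases hr with rfl | rfl
  · refine ⟨mapsInto K U, isOpen_mapsInto hU, fun _ => hc, subset_rfl, ?_⟩
    rw [contDiffOn_infty]
    exact fun k => contDiffOn_superposition_nat hU k (hf.of_le (by exact_mod_cast le_top))
  -- A single power series at `c` only reaches paths close to the constant path; this is why the
  -- statement is local there.
  · have h1 : AnalyticAt ℝ f c := (hf.contDiffAt (hU.mem_nhds hc)).analyticAt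
    obtain ⟨p, R, hp⟩ := h1
    obtain ⟨ε, hε, hεU⟩ := Metric.isOpen_iff.1 hU c hc
    obtain ⟨R', hR', hle⟩ : ∃ R' : ENNReal, 0 < R' ∧ R' ≤ R ∧ R' ≤ ENNReal.ofReal ε :=
      ⟨min R (ENNReal.ofReal ε), lt_min hp.r_pos (by simpa using hε), min_le_left _ _,
        min_le_right _ _⟩
    have hb : Metric.eball c R' ⊆ U :=
      (Metric.eball_subset_eball hle.2).trans (by rwa [Metric.eball_ofReal])
    have hp' := (hp.mono hR' hle.1).superposition (K := K) (hf.continuousOn.mono hb)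
    refine ⟨Metric.eball (ContinuousMap.const K c) R' ∩ mapsInto K U,
      Metric.isOpen_eball.inter (isOpen_mapsInto hU), ⟨Metric.mem_eball_self hR', fun _ => hc⟩,
      Set.inter_subset_right, ?_⟩
    exact (hp'.analyticOnNhd.contDiffOn Metric.isOpen_eball.uniqueDiffOn).mono Set.inter_subset_left

/-- The inverse function theorem for maps of class `C^r` on an open set, with an inverse of class
`C^r` on an open set. -/
theorem ContDiffOn.exists_openPartialHomeomorph {E F : Type*} [NormedAddCommGroup E]
    [NormedSpace ℝ E] [CompleteSpace E] [NormedAddCommGroup F] [NormedSpace ℝ F]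
    {r : WithTop ℕ∞} (hr : 1 ≤ r) {U : Set E} (hU : IsOpen U) {f : E → F}
    (hf : ContDiffOn ℝ r f U) {a : E} (ha : a ∈ U) {f' : E ≃L[ℝ] F}
    (hf' : HasFDerivAt f (f' : E →L[ℝ] F) a) :
    ∃ e : OpenPartialHomeomorph E F, ⇑e = f ∧ a ∈ e.source ∧ e.source ⊆ U ∧
      ContDiffOn ℝ r e.symm e.target := by
  have hr0 : r ≠ 0 := fun h => by simp [h] at hr
  have hfa := hf.contDiffAt (hU.mem_nhds ha)
  have hD : ContinuousOn (fderiv ℝ f) U := hf.continuousOn_fderiv_of_isOpen hU hr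
  -- The inverse is of class C^r at the image of every point where the derivative is invertible;
  -- restricting the source to these points gives regularity on the whole target.
  have hW : IsOpen (U ∩ fderiv ℝ f ⁻¹' Set.range ((↑) : (E ≃L[ℝ] F) → E →L[ℝ] F)) :=
    hD.isOpen_inter_preimage hU (ContinuousLinearEquiv.isOpen)
  refine ⟨(hfa.toOpenPartialHomeomorph f hf' hr0).restrOpen _ hW, rfl, ?_, ?_, ?_⟩
  · exact ⟨hfa.mem_toOpenPartialHomeomorph_source hf' hr0, ha, f', hf'.fderiv.symm⟩
  · exact fun x hx => hx.2.1
  · set e := (hfa.toOpenPartialHomeomorph f hf' hr0).restrOpen _ hW with he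
    intro y hy
    have hx : e.symm y ∈ e.source := e.map_target hy
    obtain ⟨hxU, A, hA⟩ := hx.2
    have hc : ContDiffAt ℝ r f (e.symm y) := hf.contDiffAt (hU.mem_nhds hxU)
    have hd : HasFDerivAt f (A : E →L[ℝ] F) (e.symm y) := by
      rw [hA]; exact (hc.differentiableAt hr0).hasFDerivAt
    exact (e.contDiffAt_symm hy hd hc).contDiffWithinAt

/-! ### Integration of paths -/

section Volterra

variable {F : Type*} [NormedAddCommGroup F] [NormedSpace ℝ F]

/-- The primitive `t ↦ ∫ s in 0..t, γ s`, with `γ` extended by constants outside `[0, 1]`. -/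
noncomputable def primitiveFun (γ : C(unitInterval, F)) (t : ℝ) : F :=
  ∫ s in (0 : ℝ)..t, γ (Set.projIcc 0 1 zero_le_one s)

theorem hasDerivAt_primitiveFun [CompleteSpace F] (γ : C(unitInterval, F)) (t : ℝ) :
    HasDerivAt (primitiveFun γ) (γ (Set.projIcc 0 1 zero_le_one t)) t := by
  have hc : Continuous fun s : ℝ => γ (Set.projIcc 0 1 zero_le_one s) :=
    γ.continuous.comp continuous_projIcc
  exact hc.integral_hasStrictDerivAt 0 t |>.hasDerivAt

theorem primitiveFun_zero (γ : C(unitInterval, F)) : primitiveFun γ 0 = 0 := by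
  simp [primitiveFun]

variable (F) in
/-- The Volterra operator `γ ↦ (t ↦ ∫ s in 0..t, γ s)` on `C([0, 1], F)`. -/
noncomputable def volterra [CompleteSpace F] : C(unitInterval, F) →L[ℝ] C(unitInterval, F) :=
  LinearMap.mkContinuous
    { toFun := fun γ => ⟨fun t => primitiveFun γ t,
        (continuous_iff_continuousAt.2 fun t =>
          (hasDerivAt_primitiveFun γ t).continuousAt).comp continuous_subtype_val⟩
      map_add' := fun γ η => by
        ext t
        simp only [primitiveFun, ContinuousMap.add_apply, ContinuousMap.coe_mk]
        exact intervalIntegral.integral_add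
          ((γ.continuous.comp continuous_projIcc).intervalIntegrable _ _)
          ((η.continuous.comp continuous_projIcc).intervalIntegrable _ _)
      map_smul' := fun c γ => by
        ext t
        simp only [primitiveFun, ContinuousMap.smul_apply, ContinuousMap.coe_mk, RingHom.id_apply]
        exact intervalIntegral.integral_smul c _ } 1 (fun γ => by
      refine (ContinuousMap.norm_le _ (by positivity)).2 fun t => ?_
      have h := intervalIntegral.norm_integral_le_of_norm_le_const (a := 0) (b := (t : ℝ))
        (f := fun s => γ (Set.projIcc 0 1 zero_le_one s)) (C := ‖γ‖)
        (fun s _ => γ.norm_coe_le_norm _)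
      refine h.trans ?_
      rw [sub_zero, abs_of_nonneg t.2.1, mul_comm]
      gcongr
      exact t.2.2)

variable (F) in
/-- Constant paths, as a continuous linear map. -/
noncomputable def constPath : F →L[ℝ] C(unitInterval, F) :=
  LinearMap.mkContinuous
    { toFun := fun x => ContinuousMap.const _ x
      map_add' := fun x y => rfl
      map_smul' := fun c x => rfl } 1 (fun x =>
      (ContinuousMap.norm_le _ (by positivity)).2 fun t => (one_mul ‖x‖).ge)

@[simp]
theorem constPath_apply (x : F) (t : unitInterval) : constPath F x t = x := rfl

variable (F) in
/-- Multiplication of a path by the time parameter. -/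
noncomputable def timeMul : C(unitInterval, F) →L[ℝ] C(unitInterval, F) :=
  applyPointwise unitInterval F F
    ⟨fun t => (t : ℝ) • ContinuousLinearMap.id ℝ F, by fun_prop⟩

@[simp]
theorem timeMul_apply (γ : C(unitInterval, F)) (t : unitInterval) :
    timeMul F γ t = (t : ℝ) • γ t := by
  simp [timeMul, applyPointwise_apply]

/-- A function of `t : ℝ` with zero derivative on `[0, 1]` takes the same values at `0` and `1`. -/
theorem eq_of_hasDerivAt_zero {f : ℝ → F} (h : ∀ t ∈ Set.Icc (0 : ℝ) 1, HasDerivAt f 0 t) :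
    f 1 = f 0 :=
  constant_of_has_deriv_right_zero (fun t ht => (h t ht).continuousAt.continuousWithinAt)
    (fun t ht => (h t ⟨ht.1, ht.2.le⟩).hasDerivWithinAt) 1 (by simp)

end Volterra

/-! ### The Poincaré lemma relative to two lines -/

section Poincare

variable {E : Type u} [NormedAddCommGroup E] [NormedSpace ℝ E]

/-- The 2-form `b` (a field of bilinear forms) is closed at `x`. -/
def ClosedAt (b : E → E →L[ℝ] E →L[ℝ] ℝ) (x : E) : Prop :=
  ∀ u v w, fderiv ℝ b x u v w = fderiv ℝ b x v u w - fderiv ℝ b x w u v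

/-- The 2-form `b` is alternating at every point of `U`. -/
def AlternatingOn (b : E → E →L[ℝ] E →L[ℝ] ℝ) (U : Set E) : Prop :=
  ∀ x ∈ U, ∀ u v, b x u v = - b x v u

/-- The 1-form `a` is a primitive at `x` of the 2-form `b`. -/
def PrimitiveAt (a : E → E →L[ℝ] ℝ) (b : E → E →L[ℝ] E →L[ℝ] ℝ) (x : E) : Prop :=
  ∀ u v, fderiv ℝ a x u v - fderiv ℝ a x v u = b x u v

/-- Integration commutes with continuous linear maps. Applied to evaluations at vectors, this
transfers pointwise identities (antisymmetry, closedness, the chain rule) to averages. -/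
theorem map_volterra {F G : Type*} [NormedAddCommGroup F] [NormedSpace ℝ F] [CompleteSpace F]
    [NormedAddCommGroup G] [NormedSpace ℝ G] [CompleteSpace G] (L : F →L[ℝ] G)
    {γ : C(unitInterval, F)} {η : C(unitInterval, G)} (h : ∀ t, L (γ t) = η t) :
    L (volterra F γ 1) = volterra G η 1 := by
  have key := eq_of_hasDerivAt_zero (f := fun t => L (primitiveFun γ t) - primitiveFun η t)
    fun t _ => by
      have h1 := (L.hasFDerivAt.comp_hasDerivAt t (hasDerivAt_primitiveFun γ t)).sub
        (hasDerivAt_primitiveFun η t)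
      rw [h, sub_self] at h1
      exact h1
  simp only [primitiveFun_zero, map_zero, sub_zero] at key
  exact sub_eq_zero.1 key

/-- The average `∫₀¹ t θ(t x) dt`. -/
noncomputable def radialMean {F : Type*} [NormedAddCommGroup F] [NormedSpace ℝ F] [CompleteSpace F]
    (θ : E → F) (x : E) : F :=
  volterra F (timeMul F (superposition unitInterval θ (timeMul E (constPath E x)))) 1

/-- Everything in `radialMean` is linear except one superposition operator, applied to the path t ↦
tx, which is the constant path at 0 for x = 0. The second `timeMul` in the derivative is the factor
t from the chain rule. -/
theorem exists_contDiffOn_radialMean {F : Type u} [NormedAddCommGroup F] [NormedSpace ℝ F]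
    [CompleteSpace F] {r : WithTop ℕ∞} (hr : r = ∞ ∨ r = ω) {U : Set E} (hU : IsOpen U)
    (h0 : (0 : E) ∈ U) {θ : E → F} (hθ : ContDiffOn ℝ r θ U) :
    ∃ O ⊆ U, IsOpen O ∧ (0 : E) ∈ O ∧ (∀ x ∈ O, ∀ t : unitInterval, (t : ℝ) • x ∈ U) ∧
      ContDiffOn ℝ r (radialMean θ) O ∧ ∀ x ∈ O, fderiv ℝ (radialMean θ) x =
        volterra (E →L[ℝ] F) (timeMul _ (timeMul _
          (superposition unitInterval (fderiv ℝ θ) (timeMul E (constPath E x))))) 1 := by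
  have hr1 : (1 : WithTop ℕ∞) ≤ r := by rcases hr with rfl | rfl <;> simp
  obtain ⟨V, hV, h0V, hVU, hsV⟩ := exists_contDiffOn_superposition unitInterval hr hU hθ h0
  let ℓ : E →L[ℝ] C(unitInterval, E) := (timeMul E).comp (constPath E)
  have hℓ : ∀ x t, ℓ x t = (t : ℝ) • x := fun x t => by simp [ℓ]
  have hℓ0 : ℓ 0 = ContinuousMap.const _ (0 : E) := by ext t; simp
  let S : C(unitInterval, F) →L[ℝ] F :=
    (ContinuousMap.evalCLM ℝ (1 : unitInterval)).comp ((volterra F).comp (timeMul F))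
  have hO : IsOpen (ℓ ⁻¹' V) := hV.preimage ℓ.continuous
  have hmem : ∀ x ∈ ℓ ⁻¹' V, ∀ t : unitInterval, (t : ℝ) • x ∈ U := fun x hx t => by
    rw [← hℓ]; exact hVU hx t
  refine ⟨ℓ ⁻¹' V, fun x hx => by simpa using hmem x hx 1, hO, by simpa [hℓ0] using h0V, hmem,
    S.contDiff.comp_contDiffOn (hsV.comp ℓ.contDiff.contDiffOn fun x hx => hx), fun x hx => ?_⟩
  have h1 := hasFDerivAt_superposition hU (hθ.of_le hr1) (hVU hx)
  have h2 := S.hasFDerivAt.comp x (h1.comp x ℓ.hasFDerivAt)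
  ext1 a
  change fderiv ℝ (S ∘ superposition unitInterval θ ∘ ℓ) x a = _
  rw [h2.fderiv]
  refine (map_volterra (ContinuousLinearMap.apply ℝ F a) fun t => ?_).symm
  simp [applyPointwise_apply, ℓ]

/-- This is the integral over [0, 1] of d/dt (t² θ(tx)) = t² Dθ(tx)x + 2t θ(tx). -/
theorem fderiv_radialMean_self {F : Type u} [NormedAddCommGroup F] [NormedSpace ℝ F]
    [CompleteSpace F] {U : Set E} (hU : IsOpen U) {θ : E → F} (hθ : ContDiffOn ℝ 1 θ U) {x : E}
    (hx : ∀ t : unitInterval, (t : ℝ) • x ∈ U)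
    (h : fderiv ℝ (radialMean θ) x = volterra (E →L[ℝ] F) (timeMul _ (timeMul _
      (superposition unitInterval (fderiv ℝ θ) (timeMul E (constPath E x))))) 1) :
    fderiv ℝ (radialMean θ) x x + (2 : ℝ) • radialMean θ x = θ x := by
  have hDθ : ContinuousOn (fderiv ℝ θ) U := hθ.continuousOn_fderiv_of_isOpen hU le_rfl
  have hmem : ∀ t, timeMul E (constPath E x) t ∈ U := fun t => by simpa using hx t
  set γ₁ := timeMul _ (timeMul _
      (superposition unitInterval (fderiv ℝ θ) (timeMul E (constPath E x)))) with hγ₁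
  set γ₂ := timeMul F (superposition unitInterval θ (timeMul E (constPath E x))) with hγ₂
  have key := eq_of_hasDerivAt_zero (f := fun t => primitiveFun γ₁ t x + (2 : ℝ) • primitiveFun γ₂ t
    - t ^ 2 • θ (t • x)) fun t ht => by
      have hp : Set.projIcc (0 : ℝ) 1 zero_le_one t = ⟨t, ht⟩ := Set.projIcc_of_mem _ ht
      have hθt : HasFDerivAt θ (fderiv ℝ θ (t • x)) (t • x) :=
        ((hθ.differentiableOn one_ne_zero).differentiableAt
          (hU.mem_nhds (hx ⟨t, ht⟩))).hasFDerivAt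
      have h1 := ((ContinuousLinearMap.apply ℝ F x).hasFDerivAt.comp_hasDerivAt t
        (hasDerivAt_primitiveFun γ₁ t)).add ((hasDerivAt_primitiveFun γ₂ t).const_smul (2 : ℝ))
      have h2 := h1.sub ((hasDerivAt_pow 2 t).smul
        (hθt.comp_hasDerivAt t ((hasDerivAt_id t).smul_const x)))
      convert! h2 using 1
      rw [hp, hγ₁, hγ₂]
      simp only [timeMul_apply, ContinuousLinearMap.apply_apply]
      rw [superposition_apply hDθ hmem, superposition_apply hθ.continuousOn hmem]
      simp only [timeMul_apply, constPath_apply, smul_apply,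
        Function.comp_apply, id_eq, one_smul]
      norm_num
      module
  simp only [primitiveFun_zero, one_pow, one_smul] at key
  rw [h, ← sub_eq_zero]
  exact key.trans (by simp)

/-- With Θ = `radialMean θ` the primitive is a(x) = Θ(x)(x, ·). Antisymmetry and closedness of Θ
turn da into DΘ(x)x + 2Θ(x), which is θ(x) by `fderiv_radialMean_self`. Antisymmetry also gives
a(x)x = 0, and Θ(0) = 0 makes the derivative of a vanish at 0. -/
theorem exists_poincare {r : WithTop ℕ∞} (hr : r = ∞ ∨ r = ω) {U : Set E} (hU : IsOpen U)
    (h0 : (0 : E) ∈ U) {θ : E → E →L[ℝ] E →L[ℝ] ℝ} (hθ : ContDiffOn ℝ r θ U)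
    (halt : AlternatingOn θ U) (hcl : ∀ x ∈ U, ClosedAt θ x) (hθ0 : θ 0 = 0) :
    ∃ O ⊆ U, IsOpen O ∧ (0 : E) ∈ O ∧ ∃ a : E → E →L[ℝ] ℝ, ContDiffOn ℝ r a O ∧
      (∀ x ∈ O, PrimitiveAt a θ x) ∧ a 0 = 0 ∧ fderiv ℝ a 0 = 0 ∧ ∀ x ∈ O, a x x = 0 := by
  have hr1 : (1 : WithTop ℕ∞) ≤ r := by rcases hr with rfl | rfl <;> simp
  have hr0 : r ≠ 0 := fun h => by simp [h] at hr1
  obtain ⟨O, hOU, hO, h0O, hmem, hΘ, hΘ'⟩ := exists_contDiffOn_radialMean hr hU h0 hθ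
  have hDθ : ContinuousOn (fderiv ℝ θ) U := hθ.continuousOn_fderiv_of_isOpen hU hr1
  have hm : ∀ x ∈ O, ∀ t, timeMul E (constPath E x) t ∈ U := fun x hx t => by
    simpa using hmem x hx t
  have ha : ContDiffOn ℝ r (fun x => radialMean θ x x) O := hΘ.clm_apply contDiffOn_id
  have hda : ∀ x ∈ O, ∀ a, fderiv ℝ (fun x => radialMean θ x x) x a =
      radialMean θ x a + fderiv ℝ (radialMean θ) x a x := fun x hx a => by
    have h1 := ((hΘ.contDiffAt (hO.mem_nhds hx)).differentiableAt hr0).hasFDerivAt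
    have h2 := h1.clm_apply (hasFDerivAt_id x)
    simp only [id_eq] at h2
    rw [h2.fderiv]; simp
  let ev : E → E → (E →L[ℝ] E →L[ℝ] ℝ) →L[ℝ] ℝ := fun u v =>
    (ContinuousLinearMap.apply ℝ ℝ v).comp (ContinuousLinearMap.apply ℝ (E →L[ℝ] ℝ) u)
  have hanti : ∀ x ∈ O, ∀ u v, radialMean θ x u v = - radialMean θ x v u := fun x hx u v => by
    have h1 := map_volterra (η := 0) (ev u v + ev v u)
      (γ := timeMul _ (superposition unitInterval θ (timeMul E (constPath E x)))) fun t => by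
        simp only [add_apply, ev, timeMul_apply, map_smul]
        rw [superposition_apply hθ.continuousOn (hm x hx)]
        have := halt _ (hm x hx t) u v
        simp_all
    simpa [ev, radialMean, ← eq_neg_iff_add_eq_zero] using h1
  have hclosed : ∀ x ∈ O, ClosedAt (radialMean θ) x := fun x hx u v w => by
    have h1 := map_volterra (η := 0) ((ev v w).comp (ContinuousLinearMap.apply ℝ _ u)
        - (ev u w).comp (ContinuousLinearMap.apply ℝ _ v)
        + (ev u v).comp (ContinuousLinearMap.apply ℝ _ w))
      (γ := timeMul _ (timeMul _
        (superposition unitInterval (fderiv ℝ θ) (timeMul E (constPath E x))))) fun t => by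
        simp only [timeMul_apply, map_smul]
        rw [superposition_apply hDθ (hm x hx)]
        have := hcl _ (hm x hx t) u v w
        simp only [timeMul_apply, constPath_apply] at this
        simp [ev, this]
    rw [← hΘ' x hx] at h1
    simp only [map_zero, ContinuousMap.zero_apply, add_apply,
      sub_apply, ContinuousLinearMap.comp_apply, ev,
      ContinuousLinearMap.apply_apply] at h1
    linarith
  have hΘ0 : radialMean θ 0 = 0 := by
    have : superposition unitInterval θ (timeMul E (constPath E 0)) = 0 := by
      ext1 t
      rw [superposition_apply hθ.continuousOn (hm 0 h0O)]
      simp [hθ0]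
    rw [radialMean, this, map_zero, map_zero]; rfl
  refine ⟨O, hOU, hO, h0O, fun x => radialMean θ x x, ha, fun x hx u v => ?_, by simp, ?_,
    fun x hx => ?_⟩
  · rw [hda x hx, hda x hx]
    have h1 := fderiv_radialMean_self hU (hθ.of_le hr1) (hmem x hx) (hΘ' x hx)
    have h2 := congrArg (fun b => b u v) h1
    simp only [add_apply, smul_apply, smul_eq_mul] at h2
    have h3 := hclosed x hx x u v
    have h4 := hanti x hx u v
    simp only [add_apply]
    linarith
  · ext a w
    rw [hda 0 h0O, hΘ0]; simp
  · have := hanti x hx x x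
    linarith

/-- The function `x ↦ a (P x) (x - P x)` attached to a 1-form `a` and a projection `P`; its
differential agrees with `a` along the range of `P` if `a` restricts to zero there. -/
def transversalPrimitive (a : E → E →L[ℝ] ℝ) (P : E →L[ℝ] E) (x : E) : ℝ := a (P x) (x - P x)

theorem contDiffOn_transversalPrimitive {r : WithTop ℕ∞} {O : Set E} {a : E → E →L[ℝ] ℝ}
    (ha : ContDiffOn ℝ r a O) (P : E →L[ℝ] E) :
    ContDiffOn ℝ r (transversalPrimitive a P) (P ⁻¹' O) :=
  (ha.comp P.contDiff.contDiffOn fun _ hx => hx).clm_apply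
    (contDiff_id.sub P.contDiff).contDiffOn

theorem fderiv_transversalPrimitive {a : E → E →L[ℝ] ℝ} {P : E →L[ℝ] E} {x : E}
    (ha : DifferentiableAt ℝ a (P x)) (w : E) :
    fderiv ℝ (transversalPrimitive a P) x w =
      fderiv ℝ a (P x) (P w) (x - P x) + a (P x) (w - P w) := by
  have h1 := (ha.hasFDerivAt.comp x P.hasFDerivAt).clm_apply
    ((hasFDerivAt_id x).sub P.hasFDerivAt)
  change fderiv ℝ (fun y => (a ∘ P) y (id y - P y)) x w = _
  erw [h1.fderiv]
  simp [add_comm]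

/-- In the formula for the first derivative, one term is a product of two factors vanishing at 0,
and the other is linear in `a ∘ P`, whose derivative at 0 vanishes. -/
theorem fderiv_fderiv_transversalPrimitive_zero {O : Set E} (hO : IsOpen O) (h0 : (0 : E) ∈ O)
    {a : E → E →L[ℝ] ℝ} (ha : ContDiffOn ℝ 2 a O) (ha0 : a 0 = 0) (hda : fderiv ℝ a 0 = 0)
    (P : E →L[ℝ] E) : fderiv ℝ (fderiv ℝ (transversalPrimitive a P)) 0 = 0 := by
  have hPO : IsOpen (P ⁻¹' O) := hO.preimage P.continuous
  have h0P : (0 : E) ∈ P ⁻¹' O := by simpa using h0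
  have hg := contDiffOn_transversalPrimitive ha P
  have hd : DifferentiableAt ℝ (fderiv ℝ (transversalPrimitive a P)) 0 :=
    (((hg.fderiv_of_isOpen hPO (m := 1) le_rfl).contDiffAt
      (hPO.mem_nhds h0P)).differentiableAt one_ne_zero)
  have hda' : DifferentiableAt ℝ (fderiv ℝ a) (P 0) :=
    (((ha.fderiv_of_isOpen hO (m := 1) le_rfl).contDiffAt
      (hO.mem_nhds (by simpa using h0))).differentiableAt one_ne_zero)
  have haP : DifferentiableAt ℝ a (P 0) :=
    (ha.contDiffAt (hO.mem_nhds (by simpa using h0))).differentiableAt two_ne_zero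
  ext h w
  have h1 : fderiv ℝ (fderiv ℝ (transversalPrimitive a P)) 0 h w =
      fderiv ℝ (fun x => fderiv ℝ (transversalPrimitive a P) x w) 0 h := by
    rw [fderiv_clm_apply hd (differentiableAt_const w)]; simp
  have h2 : (fun x => fderiv ℝ (transversalPrimitive a P) x w) =ᶠ[𝓝 0] fun x =>
      fderiv ℝ a (P x) (P w) (x - P x) + a (P x) (w - P w) := by
    filter_upwards [hPO.mem_nhds h0P] with x hx
    exact fderiv_transversalPrimitive
      ((ha.contDiffAt (hO.mem_nhds hx)).differentiableAt two_ne_zero) w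
  rw [h1, h2.fderiv_eq]
  have h3 := (((hda'.hasFDerivAt.comp (0 : E) P.hasFDerivAt).clm_apply
    (hasFDerivAt_const (P w) (0 : E))).clm_apply
    ((hasFDerivAt_id (0 : E)).sub P.hasFDerivAt)).add
    ((haP.hasFDerivAt.comp (0 : E) P.hasFDerivAt).clm_apply (hasFDerivAt_const (w - P w) (0 : E)))
  erw [h3.fderiv]
  simp [ha0, hda]

/-- Relative Poincaré lemma: a closed 2-form that vanishes at the origin has a primitive that
vanishes along two transversal lines, and vanishes to second order at the origin. -/
theorem exists_primitive_vanishing_on_lines {r : WithTop ℕ∞} (hr : r = ∞ ∨ r = ω) {U : Set E}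
    (hU : IsOpen U) (h0 : (0 : E) ∈ U) {θ : E → E →L[ℝ] E →L[ℝ] ℝ} (hθ : ContDiffOn ℝ r θ U)
    (halt : AlternatingOn θ U) (hcl : ∀ x ∈ U, ClosedAt θ x) (hθ0 : θ 0 = 0) {u v : E}
    {l m : E →L[ℝ] ℝ} (hlu : l u = 1) (hlv : l v = 0) (hmu : m u = 0) (hmv : m v = 1) :
    ∃ O ⊆ U, IsOpen O ∧ (0 : E) ∈ O ∧ ∃ a : E → E →L[ℝ] ℝ, ContDiffOn ℝ r a O ∧
      (∀ x ∈ O, PrimitiveAt a θ x) ∧ fderiv ℝ a 0 = 0 ∧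
      (∀ s : ℝ, s • u ∈ O → a (s • u) = 0) ∧ (∀ s : ℝ, s • v ∈ O → a (s • v) = 0) := by
  have hr2 : (2 : WithTop ℕ∞) ≤ r := by
    rcases hr with rfl | rfl
    · exact WithTop.coe_le_coe.2 (le_top : (2 : ℕ∞) ≤ ⊤)
    · exact le_top
  have hr1 : r + 1 ≤ r := by rcases hr with rfl | rfl <;> simp
  have hr0 : r ≠ 0 := fun h => by simp [h] at hr2
  obtain ⟨O, hOU, hO, h0O, a, ha, hprim, ha0, hda0, haxx⟩ := exists_poincare hr hU h0 hθ halt hcl hθ0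
  -- `P` and `Q` project onto the two lines and each kills the other line. On ℝu the differential of
  -- the `P`-term equals `a`, because `a` is zero on `u` there, while the `Q`-term contributes only
  -- values at 0; on ℝv the roles are exchanged. So `a - df` vanishes on both lines.
  set P := l.smulRight u with hP
  set Q := m.smulRight v with hQ
  set f := fun x => transversalPrimitive a P x + transversalPrimitive a Q x with hf
  set O' := O ∩ (P ⁻¹' O ∩ Q ⁻¹' O) with hO'
  have hPO := hO.preimage P.continuous
  have hQO := hO.preimage Q.continuous
  have hO'o : IsOpen O' := hO.inter (hPO.inter hQO)
  have hdiff : ∀ x ∈ O, DifferentiableAt ℝ a x := fun x hx =>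
    (ha.contDiffAt (hO.mem_nhds hx)).differentiableAt hr0
  have hcP := contDiffOn_transversalPrimitive ha P
  have hcQ := contDiffOn_transversalPrimitive ha Q
  have hfc : ContDiffOn ℝ r f O' :=
    (hcP.mono fun x hx => hx.2.1).add (hcQ.mono fun x hx => hx.2.2)
  have hdf : ContDiffOn ℝ r (fderiv ℝ f) O' := hfc.fderiv_of_isOpen hO'o hr1
  have h0O' : (0 : E) ∈ O' := by simp [hO', h0O]
  have hdP : ∀ x ∈ O', DifferentiableAt ℝ (transversalPrimitive a P) x := fun x hx =>
    (hcP.contDiffAt (hPO.mem_nhds hx.2.1)).differentiableAt hr0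
  have hdQ : ∀ x ∈ O', DifferentiableAt ℝ (transversalPrimitive a Q) x := fun x hx =>
    (hcQ.contDiffAt (hQO.mem_nhds hx.2.2)).differentiableAt hr0
  have hdfx : ∀ x ∈ O', fderiv ℝ f x = fderiv ℝ (transversalPrimitive a P) x +
      fderiv ℝ (transversalPrimitive a Q) x := fun x hx => fderiv_add (hdP x hx) (hdQ x hx)
  have hdd : ∀ x ∈ O', DifferentiableAt ℝ (fderiv ℝ f) x := fun x hx =>
    (hdf.contDiffAt (hO'o.mem_nhds hx)).differentiableAt hr0
  have hda : ∀ x ∈ O', fderiv ℝ (fun y => a y - fderiv ℝ f y) x =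
      fderiv ℝ a x - fderiv ℝ (fderiv ℝ f) x := fun x hx =>
    fderiv_sub (hdiff x hx.1) (hdd x hx)
  have haline : ∀ s : ℝ, ∀ w, s • w ∈ O → a (s • w) w = 0 := fun s w hs => by
    by_cases h : s = 0
    · simp [h, ha0]
    · have := haxx _ hs
      rw [map_smul, smul_eq_mul] at this
      exact (mul_eq_zero.1 this).resolve_left h
  refine ⟨O', fun x hx => hOU hx.1, hO'o, h0O', fun x => a x - fderiv ℝ f x,
    (ha.mono fun x hx => hx.1).sub hdf, fun x hx w z => ?_, ?_, fun s hs => ?_, fun s hs => ?_⟩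
  · rw [hda x hx]
    have h1 := hprim x hx.1 w z
    -- Symmetry of the second derivative says d(df) = 0, so subtracting df keeps a primitive.
    have h2 : IsSymmSndFDerivAt ℝ f x :=
      (hfc.contDiffAt (hO'o.mem_nhds hx)).isSymmSndFDerivAt (by simpa using hr2)
    have h3 := h2 w z
    simp only [sub_apply]
    linarith
  · rw [hda 0 h0O', hda0, zero_sub, neg_eq_zero]
    have h1 : fderiv ℝ f =ᶠ[𝓝 0] fun x => fderiv ℝ (transversalPrimitive a P) x +
        fderiv ℝ (transversalPrimitive a Q) x := by
      filter_upwards [hO'o.mem_nhds h0O'] with x hx using hdfx x hx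
    rw [h1.fderiv_eq]
    have h2 := ((hcP.fderiv_of_isOpen hPO hr1).contDiffAt
      (hPO.mem_nhds h0O'.2.1)).differentiableAt hr0
    have h3 := ((hcQ.fderiv_of_isOpen hQO hr1).contDiffAt
      (hQO.mem_nhds h0O'.2.2)).differentiableAt hr0
    have h4 := fderiv_add h2 h3
    refine h4.trans ?_
    rw [fderiv_fderiv_transversalPrimitive_zero hO h0O (ha.of_le hr2) ha0 hda0,
      fderiv_fderiv_transversalPrimitive_zero hO h0O (ha.of_le hr2) ha0 hda0, add_zero]
  · ext w
    have hPs : P (s • u) = s • u := by simp [hP, hlu]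
    have hQs : Q (s • u) = 0 := by simp [hQ, hmu]
    have hPw : P w = l w • u := rfl
    simp only [sub_apply]
    rw [hdfx _ hs, add_apply, fderiv_transversalPrimitive (hdiff _ hs.2.1),
      fderiv_transversalPrimitive (hdiff _ hs.2.2), hPs, hQs, hda0, ha0, hPw]
    simp [haline s u hs.1]
  · ext w
    have hPs : P (s • v) = 0 := by simp [hP, hlv]
    have hQs : Q (s • v) = s • v := by simp [hQ, hmv]
    have hQw : Q w = m w • v := rfl
    simp only [sub_apply]
    rw [hdfx _ hs, add_apply, fderiv_transversalPrimitive (hdiff _ hs.2.1),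
      fderiv_transversalPrimitive (hdiff _ hs.2.2), hPs, hQs, hda0, ha0, hQw]
    simp [haline s v hs.1]

end Poincare

/-! ### Flows and Moser's method -/

section Moser

variable {E : Type u} [NormedAddCommGroup E] [NormedSpace ℝ E]

/-- The flow of a time-dependent vector field with vanishing first-order jet at the origin, in
integral form: `Z` is the operator that composes a path with the vector field. -/
theorem exists_flow [CompleteSpace E] {r : WithTop ℕ∞} (hr : 1 ≤ r)
    {V : Set C(unitInterval, E)} (hV : IsOpen V) (h0 : 0 ∈ V)
    {Z : C(unitInterval, E) → C(unitInterval, E)} (hZ : ContDiffOn ℝ r Z V) (hZ0 : Z 0 = 0)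
    (hdZ : fderiv ℝ Z 0 = 0) :
    ∃ (O : Set E) (Γ : E → C(unitInterval, E)), IsOpen O ∧ 0 ∈ O ∧ ContDiffOn ℝ r Γ O ∧ Γ 0 = 0 ∧
      fderiv ℝ Γ 0 = constPath E ∧
      (∀ x ∈ O, Γ x ∈ V ∧ Γ x = constPath E x + volterra E (Z (Γ x)) ∧
        ∀ a, fderiv ℝ Γ x a = constPath E a + volterra E (fderiv ℝ Z (Γ x) (fderiv ℝ Γ x a))) ∧
      ∀ x ∈ O, Z (constPath E x) = 0 → Γ x = constPath E x := by
  have hr0 : r ≠ 0 := fun h => by simp [h] at hr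
  have hZd : ∀ γ ∈ V, HasFDerivAt Z (fderiv ℝ Z γ) γ := fun γ hγ =>
    ((hZ.contDiffAt (hV.mem_nhds hγ)).differentiableAt hr0).hasFDerivAt
  -- The flow line from x solves `H γ = constPath E x`. Since the derivative of `Z` at 0 vanishes,
  -- `H` has identity derivative there and is locally invertible.
  set H : C(unitInterval, E) → C(unitInterval, E) := fun γ => γ - volterra E (Z γ) with hH
  have hHc : ContDiffOn ℝ r H V := contDiffOn_id.sub ((volterra E).contDiff.comp_contDiffOn hZ)
  have hH0 : HasFDerivAt H ((ContinuousLinearEquiv.refl ℝ C(unitInterval, E) :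
      C(unitInterval, E) ≃L[ℝ] C(unitInterval, E)) : C(unitInterval, E) →L[ℝ] C(unitInterval, E))
      0 := by
    have := (hasFDerivAt_id (0 : C(unitInterval, E))).sub
      ((volterra E).hasFDerivAt.comp 0 (hZd 0 h0))
    convert! this using 1
    rw [hdZ]; ext; simp
  obtain ⟨e, he, he0, heV, hes⟩ := hHc.exists_openPartialHomeomorph hr hV h0 hH0
  have hH00 : H 0 = 0 := by simp [hH, hZ0]
  have het : (0 : C(unitInterval, E)) ∈ e.target := by
    have := e.map_source he0
    rwa [he, hH00] at this
  have hes0 : e.symm 0 = 0 := by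
    have := e.left_inv he0
    rwa [he, hH00] at this
  -- Constant paths must lie in the target for the flow to be defined, and in the source so that a
  -- stationary path is recognised as the flow line by injectivity of `e`.
  set O := constPath E ⁻¹' (e.target ∩ e.source) with hO
  have hOo : IsOpen O := (e.open_target.inter e.open_source).preimage (constPath E).continuous
  have h0O : (0 : E) ∈ O := by simp [hO, het, he0]
  have hΓ : ContDiffOn ℝ r (e.symm ∘ constPath E) O :=
    hes.comp (constPath E).contDiff.contDiffOn fun x hx => hx.1
  have heq : ∀ x ∈ O, e.symm (constPath E x) =
      constPath E x + volterra E (Z (e.symm (constPath E x))) := fun x hx => by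
    have := e.right_inv hx.1
    rw [he] at this
    exact sub_eq_iff_eq_add.1 this
  have hmem : ∀ x ∈ O, e.symm (constPath E x) ∈ V := fun x hx => heV (e.map_target hx.1)
  refine ⟨O, e.symm ∘ constPath E, hOo, h0O, hΓ, by simp [hes0], ?_, fun x hx =>
    ⟨hmem x hx, heq x hx, fun a => ?_⟩, fun x hx hx0 => ?_⟩
  · have h1 : HasFDerivAt e.symm ((ContinuousLinearEquiv.refl ℝ C(unitInterval, E)).symm :
        C(unitInterval, E) →L[ℝ] C(unitInterval, E)) (constPath E 0) := by
      rw [map_zero]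
      exact e.hasFDerivAt_symm het (by rw [he, hes0]; exact hH0)
    rw [(h1.comp 0 (constPath E).hasFDerivAt).fderiv]
    ext; simp
  · have h1 : HasFDerivAt (e.symm ∘ constPath E) (fderiv ℝ (e.symm ∘ constPath E) x) x :=
      ((hΓ.contDiffAt (hOo.mem_nhds hx)).differentiableAt hr0).hasFDerivAt
    have h2 := (constPath E).hasFDerivAt.add ((volterra E).hasFDerivAt.comp x
      ((hZd _ (hmem x hx)).comp x h1))
    have h3 : e.symm ∘ constPath E =ᶠ[𝓝 x] fun x => constPath E x +
        volterra E (Z (e.symm (constPath E x))) := by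
      filter_upwards [hOo.mem_nhds hx] with y hy using heq y hy
    have h4 := (h2.congr_of_eventuallyEq h3).fderiv
    conv_lhs => rw [h4]
    rfl
  · have h1 := e.left_inv hx.2
    have h2 : H (constPath E x) = constPath E x := by simp [hH, hx0]
    rwa [he, h2] at h1

/-- Cartan's formula in coordinates: for closed b the Lie derivative L_X b is d(b(X, ·)) = -dα = -θ.
It is applied with b + tθ in the role of `b`. -/
theorem moser_identity {b θ : E → E →L[ℝ] E →L[ℝ] ℝ} {α : E → E →L[ℝ] ℝ} {X : E → E} {y : E}
    (hb : DifferentiableAt ℝ b y) (hX : DifferentiableAt ℝ X y)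
    (halt : ∀ u v, b y u v = - b y v u) (hcl : ClosedAt b y) (hprim : PrimitiveAt α θ y)
    (h : ∀ᶠ z in 𝓝 y, b z (X z) = - α z) (A B : E) :
    θ y A B + fderiv ℝ b y (X y) A B + b y (fderiv ℝ X y A) B + b y A (fderiv ℝ X y B) = 0 := by
  have h1 : α =ᶠ[𝓝 y] fun z => - b z (X z) := by
    filter_upwards [h] with z hz
    rw [hz, neg_neg]
  have h2 : ∀ C D, fderiv ℝ α y C D = - (b y (fderiv ℝ X y C) D + fderiv ℝ b y C (X y) D) := by
    intro C D
    rw [h1.fderiv_eq]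
    erw [((hb.hasFDerivAt.clm_apply hX.hasFDerivAt).neg).fderiv]
    simp
  have h3 := hprim A B
  have h4 := hcl (X y) A B
  have h5 := halt A (fderiv ℝ X y B)
  rw [h2, h2] at h3
  linarith

/-- The solution `X` of `(b + ξ)(X, ·) = -α`. -/
noncomputable def moserSolution (b : E → E →L[ℝ] E →L[ℝ] ℝ) (α : E → E →L[ℝ] ℝ)
    (q : E × (E →L[ℝ] E →L[ℝ] ℝ)) : E :=
  - (b q.1 + q.2).inverse (α q.1)

theorem contDiffOn_moserSolution [CompleteSpace E] {r : WithTop ℕ∞} {U : Set E} (hU : IsOpen U)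
    {b : E → E →L[ℝ] E →L[ℝ] ℝ} {α : E → E →L[ℝ] ℝ} (hb : ContDiffOn ℝ r b U)
    (hα : ContDiffOn ℝ r α U) :
    ∃ W : Set (E × (E →L[ℝ] E →L[ℝ] ℝ)), IsOpen W ∧
      (∀ q, q ∈ W ↔ q.1 ∈ U ∧ (b q.1 + q.2).IsInvertible) ∧
      ContDiffOn ℝ r (moserSolution b α) W := by
  have h1 : ContDiffOn ℝ r (fun q : E × (E →L[ℝ] E →L[ℝ] ℝ) => b q.1 + q.2) (Prod.fst ⁻¹' U) :=
    (hb.comp contDiff_fst.contDiffOn fun q hq => hq).add contDiff_snd.contDiffOn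
  have hUo : IsOpen (Prod.fst ⁻¹' U : Set (E × (E →L[ℝ] E →L[ℝ] ℝ))) := hU.preimage continuous_fst
  refine ⟨Prod.fst ⁻¹' U ∩ (fun q => b q.1 + q.2) ⁻¹'
    Set.range ((↑) : (E ≃L[ℝ] (E →L[ℝ] ℝ)) → E →L[ℝ] E →L[ℝ] ℝ),
    h1.continuousOn.isOpen_inter_preimage hUo ContinuousLinearEquiv.isOpen, fun q => Iff.rfl, ?_⟩
  rintro q ⟨hq, M, hM⟩
  have h2 := h1.contDiffAt (hUo.mem_nhds hq)
  have h3 : ContDiffAt ℝ r (fun q : E × (E →L[ℝ] E →L[ℝ] ℝ) => (b q.1 + q.2).inverse) q := by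
    refine ContDiffAt.comp q (g := ContinuousLinearMap.inverse) ?_ h2
    rw [show b q.1 + q.2 = M from hM.symm]
    exact contDiffAt_map_inverse M
  have h4 : ContDiffAt ℝ r (fun q : E × (E →L[ℝ] E →L[ℝ] ℝ) => α q.1) q :=
    (hα.comp contDiff_fst.contDiffOn fun q hq => hq).contDiffAt (hUo.mem_nhds hq)
  exact (h3.clm_apply h4).neg.contDiffWithinAt

/-- Time enters `moserSolution` only through the parameter ξ = tθ(x). As θ(0) = 0, the path t ↦ (γ
t, tθ(γ t)) is constant for γ = 0, so the superposition theorem near constant paths applies; with t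
itself as a variable it would not. The derivative of `Z` at 0 vanishes because both `α` and its
derivative do. -/
theorem exists_moserField [CompleteSpace E] {r : WithTop ℕ∞} (hr : r = ∞ ∨ r = ω) {U : Set E}
    (hU : IsOpen U) (h0 : (0 : E) ∈ U) {b θ : E → E →L[ℝ] E →L[ℝ] ℝ} {α : E → E →L[ℝ] ℝ}
    (hb : ContDiffOn ℝ r b U) (hθ : ContDiffOn ℝ r θ U) (hα : ContDiffOn ℝ r α U)
    (hb0 : (b 0).IsInvertible) (hθ0 : θ 0 = 0) (hα0 : α 0 = 0) (hdα : fderiv ℝ α 0 = 0) :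
    ∃ (V : Set C(unitInterval, E)) (Z : C(unitInterval, E) → C(unitInterval, E)) (X : ℝ → E → E),
      IsOpen V ∧ 0 ∈ V ∧ V ⊆ mapsInto unitInterval U ∧ ContDiffOn ℝ r Z V ∧ fderiv ℝ Z 0 = 0 ∧
      (∀ t x, α x = 0 → X t x = 0) ∧
      ∀ γ ∈ V, ∀ t : unitInterval, Z γ t = X t (γ t) ∧ DifferentiableAt ℝ (X t) (γ t) ∧
        (∀ h, fderiv ℝ Z γ h t = fderiv ℝ (X t) (γ t) (h t)) ∧
        ∀ᶠ z in 𝓝 (γ t), (b z + (t : ℝ) • θ z) (X t z) = - α z := by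
  have hr1 : (1 : WithTop ℕ∞) ≤ r := by rcases hr with rfl | rfl <;> simp
  have hr0 : r ≠ 0 := fun h => by simp [h] at hr1
  obtain ⟨W, hW, hWmem, hf⟩ := contDiffOn_moserSolution hU hb hα
  have h0W : (0, 0) ∈ W := (hWmem _).2 ⟨h0, by simpa using hb0⟩
  obtain ⟨V₁, hV₁, h0V₁, hV₁U, hs₁⟩ := exists_contDiffOn_superposition unitInterval hr hU hθ h0
  obtain ⟨V₂, hV₂, h0V₂, hV₂W, hs₂⟩ := exists_contDiffOn_superposition unitInterval hr hW hf h0W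
  set f := moserSolution b α with hfdef
  let L₁ := (ContinuousLinearMap.inl ℝ E (E →L[ℝ] E →L[ℝ] ℝ)).compLeftContinuous ℝ unitInterval
  let L₂ := ((ContinuousLinearMap.inr ℝ E (E →L[ℝ] E →L[ℝ] ℝ)).compLeftContinuous ℝ
    unitInterval).comp (timeMul _)
  let j : C(unitInterval, E) → C(unitInterval, E × (E →L[ℝ] E →L[ℝ] ℝ)) := fun γ =>
    L₁ γ + L₂ (superposition unitInterval θ γ)
  have hj : ContDiffOn ℝ r j V₁ := L₁.contDiff.contDiffOn.add (L₂.contDiff.comp_contDiffOn hs₁)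
  have hjt : ∀ γ ∈ V₁, ∀ t, j γ t = (γ t, (t : ℝ) • θ (γ t)) := fun γ hγ t => by
    simp [j, L₁, L₂, superposition_apply hθ.continuousOn (hV₁U hγ)]
  set V := V₁ ∩ j ⁻¹' V₂ with hVdef
  have hV : IsOpen V := hj.continuousOn.isOpen_inter_preimage hV₁ hV₂
  have h0V₁' : (0 : C(unitInterval, E)) ∈ V₁ := h0V₁
  have hj0 : j 0 = ContinuousMap.const _ (0, 0) := by
    ext1 t
    rw [hjt 0 h0V₁']
    simp [hθ0]
  have h0V : 0 ∈ V := ⟨h0V₁', by rw [Set.mem_preimage, hj0]; exact h0V₂⟩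
  set Z := superposition unitInterval f ∘ j with hZdef
  have hZ : ContDiffOn ℝ r Z V := hs₂.comp (hj.mono fun γ hγ => hγ.1) fun γ hγ => hγ.2
  let X : ℝ → E → E := fun t x => f (x, t • θ x)
  have hWt : ∀ γ ∈ V, ∀ t : unitInterval, (γ t, (t : ℝ) • θ (γ t)) ∈ W := fun γ hγ t => by
    rw [← hjt γ hγ.1]; exact hV₂W hγ.2 t
  have hZt : ∀ γ ∈ V, ∀ t : unitInterval, Z γ t = X t (γ t) := fun γ hγ t => by
    simp only [hZdef, Function.comp_apply, X]
    rw [superposition_apply hf.continuousOn (hV₂W hγ.2), hjt γ hγ.1]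
  have hθd : ∀ γ ∈ V, ∀ t : unitInterval, DifferentiableAt ℝ θ (γ t) := fun γ hγ t =>
    (hθ.contDiffAt (hU.mem_nhds (hV₁U hγ.1 t))).differentiableAt hr0
  have hXd : ∀ γ ∈ V, ∀ t : unitInterval, DifferentiableAt ℝ (X t) (γ t) := fun γ hγ t =>
    DifferentiableAt.comp (γ t) (g := f)
      ((hf.contDiffAt (hW.mem_nhds (hWt γ hγ t))).differentiableAt hr0)
      (differentiableAt_id.prodMk ((hθd γ hγ t).const_smul (t : ℝ)))
  have hdZ : ∀ γ ∈ V, ∀ t : unitInterval, ∀ h,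
      fderiv ℝ Z γ h t = fderiv ℝ (X t) (γ t) (h t) := fun γ hγ t h => by
    let ev := ContinuousMap.evalCLM ℝ (M := E) t
    have h1 : HasFDerivAt Z (fderiv ℝ Z γ) γ :=
      ((hZ.contDiffAt (hV.mem_nhds hγ)).differentiableAt hr0).hasFDerivAt
    have h2 := ev.hasFDerivAt.comp γ h1
    have h3 : HasFDerivAt (X t ∘ ev) _ γ :=
      HasFDerivAt.comp γ (g := X t) (hXd γ hγ t).hasFDerivAt ev.hasFDerivAt
    have h4 : ev ∘ Z =ᶠ[𝓝 γ] X t ∘ ev := by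
      filter_upwards [hV.mem_nhds hγ] with η hη using hZt η hη t
    exact congrArg (fun L => L h) (h2.unique (h3.congr_of_eventuallyEq h4))
  have hX0 : ∀ t x, α x = 0 → X t x = 0 := fun t x hx => by
    simp [X, hfdef, moserSolution, hx]
  refine ⟨V, Z, X, hV, h0V, fun γ hγ => hV₁U hγ.1, hZ, ?_, hX0, fun γ hγ t =>
    ⟨hZt γ hγ t, hXd γ hγ t, hdZ γ hγ t, ?_⟩⟩
  · ext1 h
    ext1 t
    rw [hdZ 0 h0V t h]
    have hc : DifferentiableAt ℝ (fun x => (b x + (t : ℝ) • θ x).inverse) 0 := by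
      have h1 : ContDiffAt ℝ r (fun x => b x + (t : ℝ) • θ x) 0 :=
        (hb.contDiffAt (hU.mem_nhds h0)).add
          ((hθ.contDiffAt (hU.mem_nhds h0)).const_smul (t : ℝ))
      refine ContDiffAt.differentiableAt (n := r) ?_ hr0
      refine ContDiffAt.comp (0 : E) (g := ContinuousLinearMap.inverse) ?_ h1
      refine ContinuousLinearMap.IsInvertible.contDiffAt_map_inverse ?_
      simpa [hθ0] using hb0
    have hαd : DifferentiableAt ℝ α 0 := (hα.contDiffAt (hU.mem_nhds h0)).differentiableAt hr0
    have h2 := (hc.hasFDerivAt.clm_apply hαd.hasFDerivAt).neg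
    have h3 : fderiv ℝ (X t) 0 = _ := h2.fderiv
    simp only [ContinuousMap.zero_apply]
    rw [h3]
    simp [hα0, hdα]
  · have h1 : ContinuousAt (fun z => (z, (t : ℝ) • θ z)) (γ t) :=
      continuousAt_id.prodMk ((hθd γ hγ t).continuousAt.const_smul (t : ℝ))
    filter_upwards [h1.preimage_mem_nhds (hW.mem_nhds (hWt γ hγ t))] with z hz
    obtain ⟨-, M, hM⟩ := (hWmem _).1 hz
    simp only [X, hfdef, moserSolution] at hM ⊢
    rw [← hM]
    simp

theorem ClosedAt.add_smul_sub {b c : E → E →L[ℝ] E →L[ℝ] ℝ} {y : E}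
    (hb : ClosedAt b y) (hc : ClosedAt c y) (hbd : DifferentiableAt ℝ b y)
    (hcd : DifferentiableAt ℝ c y) (t : ℝ) : ClosedAt (fun z => b z + t • (c z - b z)) y := by
  intro u v w
  have h : fderiv ℝ (fun z => b z + t • (c z - b z)) y =
      fderiv ℝ b y + t • (fderiv ℝ c y - fderiv ℝ b y) :=
    (hbd.hasFDerivAt.add ((hcd.hasFDerivAt.sub hbd.hasFDerivAt).const_smul t)).fderiv
  rw [h]
  simp only [add_apply, smul_apply, sub_apply, smul_eq_mul]
  rw [hb u v w, hc u v w]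
  ring

/-- Moser's method relative to two transversal lines: two symplectic forms that agree at the origin
are related by a local diffeomorphism fixing the points of the lines. -/
theorem exists_moser [CompleteSpace E] {r : WithTop ℕ∞} (hr : r = ∞ ∨ r = ω) {U : Set E}
    (hU : IsOpen U) (h0 : (0 : E) ∈ U) {b c : E → E →L[ℝ] E →L[ℝ] ℝ}
    (hb : ContDiffOn ℝ r b U) (hc : ContDiffOn ℝ r c U)
    (hba : AlternatingOn b U) (hca : AlternatingOn c U)
    (hbc : ∀ x ∈ U, ClosedAt b x) (hcc : ∀ x ∈ U, ClosedAt c x)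
    (h00 : c 0 = b 0) (hb0 : (b 0).IsInvertible) {u v : E} {l m : E →L[ℝ] ℝ}
    (hlu : l u = 1) (hlv : l v = 0) (hmu : m u = 0) (hmv : m v = 1) :
    ∃ e : OpenPartialHomeomorph E E, 0 ∈ e.source ∧ e 0 = 0 ∧ e.source ⊆ U ∧ e.target ⊆ U ∧
      ContDiffOn ℝ r e e.source ∧ ContDiffOn ℝ r e.symm e.target ∧
      (∀ x ∈ e.source, ∀ A B, c (e x) (fderiv ℝ e x A) (fderiv ℝ e x B) = b x A B) ∧
      (∀ s : ℝ, s • u ∈ e.source → e (s • u) = s • u) ∧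
      (∀ s : ℝ, s • v ∈ e.source → e (s • v) = s • v) := by
  have hr1 : (1 : WithTop ℕ∞) ≤ r := by rcases hr with rfl | rfl <;> simp
  have hr0 : r ≠ 0 := fun h => by simp [h] at hr1
  set θ : E → E →L[ℝ] E →L[ℝ] ℝ := fun x => c x - b x with hθdef
  have hbd : ∀ x ∈ U, DifferentiableAt ℝ b x := fun x hx =>
    (hb.contDiffAt (hU.mem_nhds hx)).differentiableAt hr0
  have hcd : ∀ x ∈ U, DifferentiableAt ℝ c x := fun x hx =>
    (hc.contDiffAt (hU.mem_nhds hx)).differentiableAt hr0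
  have hθ : ContDiffOn ℝ r θ U := hc.sub hb
  have hθ0 : θ 0 = 0 := by simp [hθdef, h00]
  have hθa : AlternatingOn θ U := fun x hx y z => by
    simp only [hθdef, sub_apply]
    rw [hba x hx y z, hca x hx y z]; ring
  have hθc : ∀ x ∈ U, ClosedAt θ x := fun x hx y z w => by
    have h : fderiv ℝ θ x = fderiv ℝ c x - fderiv ℝ b x :=
      ((hcd x hx).hasFDerivAt.sub (hbd x hx).hasFDerivAt).fderiv
    rw [h]
    simp only [sub_apply]
    rw [hbc x hx y z w, hcc x hx y z w]; ring
  obtain ⟨O, hOU, hO, h0O, α, hα, hprim, hdα, hαu, hαv⟩ :=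
    exists_primitive_vanishing_on_lines hr hU h0 hθ hθa hθc hθ0 hlu hlv hmu hmv
  have hα0 : α 0 = 0 := by simpa using hαu 0 (by simpa using h0O)
  obtain ⟨V, Z, X, hV, h0V, hVO, hZ, hdZ, hX0, hVX⟩ :=
    exists_moserField hr hO h0O (hb.mono hOU) (hθ.mono hOU) hα hb0 hθ0 hα0 hdα
  have hZ0 : Z 0 = 0 := by
    ext1 t
    rw [(hVX 0 h0V t).1]
    exact hX0 _ _ hα0
  obtain ⟨O', Γ, hO', h0O', hΓ, hΓ0, hdΓ0, hΓx, hΓfix⟩ := exists_flow hr1 hV h0V hZ hZ0 hdZ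
  let ev := ContinuousMap.evalCLM ℝ (M := E) (1 : unitInterval)
  set Φ : E → E := ev ∘ Γ with hΦ
  have hΦc : ContDiffOn ℝ r Φ O' := ev.contDiff.comp_contDiffOn hΓ
  have hΓd : ∀ x ∈ O', HasFDerivAt Γ (fderiv ℝ Γ x) x := fun x hx =>
    ((hΓ.contDiffAt (hO'.mem_nhds hx)).differentiableAt hr0).hasFDerivAt
  have hΦd : ∀ x ∈ O', HasFDerivAt Φ (ev.comp (fderiv ℝ Γ x)) x := fun x hx =>
    ev.hasFDerivAt.comp x (hΓd x hx)
  have hΦ0 : HasFDerivAt Φ ((ContinuousLinearEquiv.refl ℝ E : E ≃L[ℝ] E) : E →L[ℝ] E) 0 := by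
    have := hΦd 0 h0O'
    rw [hdΓ0] at this
    exact this
  -- The extra restriction puts the constant path at x in `V`; thus x lies in `O`, and `Z` can be
  -- evaluated on that path when x is on one of the lines.
  obtain ⟨e, he, he0, heO', hes⟩ :=
    (hΦc.mono (Set.inter_subset_left (t := constPath E ⁻¹' V))).exists_openPartialHomeomorph hr1
      (hO'.inter (hV.preimage (constPath E).continuous)) ⟨h0O', by simpa using h0V⟩ hΦ0
  have hcO : ∀ x, constPath E x ∈ V → x ∈ O := fun x hx => hVO hx 1
  have hline : ∀ x ∈ O', constPath E x ∈ V → α x = 0 → Φ x = x := fun x hx hxV hαx => by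
    have hZx : Z (constPath E x) = 0 := by
      ext1 t
      rw [(hVX _ hxV t).1]
      exact hX0 _ _ hαx
    rw [hΦ, Function.comp_apply, hΓfix x hx hZx]; rfl
  refine ⟨e, he0, ?_, fun x hx => hOU (hcO x (heO' hx).2), fun y hy => ?_, ?_, hes, fun x hx A B => ?_,
    fun s hs => ?_, fun s hs => ?_⟩
  · rw [he, hΦ, Function.comp_apply, hΓ0]; rfl
  · have h1 := e.map_target hy
    have h2 := hOU (hVO (hΓx _ (heO' h1).1).1 1)
    have h3 := e.right_inv hy
    rw [he] at h3
    rw [← h3]; exact h2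
  · rw [he]; exact hΦc.mono fun x hx => (heO' hx).1
  · obtain ⟨hxV, hxΓ, hxd⟩ := hΓx x (heO' hx).1
    rw [he, (hΦd x (heO' hx).1).fderiv]
    -- The flow line and its variations live on [0, 1]; `g` and `a` agree with them there and are
    -- differentiable at real times, endpoints included.
    set g : ℝ → E := fun t => x + primitiveFun (Z (Γ x)) t with hg
    set a : E → ℝ → E := fun A t => A + primitiveFun (fderiv ℝ Z (Γ x) (fderiv ℝ Γ x A)) t with ha
    have hgt : ∀ t : unitInterval, g t = Γ x t := fun t =>
      (congrArg (fun γ : C(unitInterval, E) => γ t) hxΓ).symm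
    have hat : ∀ A, ∀ t : unitInterval, a A t = fderiv ℝ Γ x A t := fun A t =>
      (congrArg (fun γ : C(unitInterval, E) => γ t) (hxd A)).symm
    -- The pull-back of b + tθ under the time-t flow is constant in t: it is `b` at time 0 and the
    -- pull-back of `c` at time 1.
    have key := eq_of_hasDerivAt_zero
      (f := fun t => (b (g t) + t • θ (g t)) (a A t) (a B t)) fun t ht => by
        have hp : Set.projIcc (0 : ℝ) 1 zero_le_one t = ⟨t, ht⟩ := Set.projIcc_of_mem _ ht
        set τ : unitInterval := ⟨t, ht⟩ with hτ
        have hgτ : g t = Γ x τ := hgt τ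
        have haτ : ∀ A, a A t = fderiv ℝ Γ x A τ := fun A => hat A τ
        obtain ⟨hZτ, hXτ, hdZτ, hev⟩ := hVX (Γ x) hxV τ
        have hyO : Γ x τ ∈ O := hVO hxV τ
        have hyU : Γ x τ ∈ U := hOU hyO
        have hg' : HasDerivAt g (X t (Γ x τ)) t := by
          have h := (hasDerivAt_primitiveFun (Z (Γ x)) t).const_add x
          rw [hp, hZτ] at h
          exact h
        have ha' : ∀ A, HasDerivAt (a A) (fderiv ℝ (X t) (Γ x τ) (a A t)) t := fun A => by
          have h := (hasDerivAt_primitiveFun (fderiv ℝ Z (Γ x) (fderiv ℝ Γ x A)) t).const_add A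
          rw [hp, hdZτ, ← haτ] at h
          exact h
        have hb' : HasDerivAt (fun t => b (g t)) (fderiv ℝ b (Γ x τ) (X t (Γ x τ))) t := by
          have h := (hbd _ hyU).hasFDerivAt
          rw [← hgτ] at h ⊢
          rw [← hgτ] at hg'
          exact h.comp_hasDerivAt t hg'
        have hc' : HasDerivAt (fun t => c (g t)) (fderiv ℝ c (Γ x τ) (X t (Γ x τ))) t := by
          have h := (hcd _ hyU).hasFDerivAt
          rw [← hgτ] at h ⊢
          rw [← hgτ] at hg'
          exact h.comp_hasDerivAt t hg'
        have h1 := ((hb'.add ((hasDerivAt_id t).smul (hc'.sub hb'))).clm_apply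
          (ha' A)).clm_apply (ha' B)
        have hid := moser_identity (b := fun z => b z + t • θ z) (θ := θ) (α := α) (X := X t)
          (y := Γ x τ) ((hbd _ hyU).add (((hcd _ hyU).sub (hbd _ hyU)).const_smul t)) hXτ
          (fun y z => by
            simp only [add_apply, smul_apply, smul_eq_mul]
            rw [hba _ hyU y z, hθa _ hyU y z]; ring)
          ((hbc _ hyU).add_smul_sub (hcc _ hyU) (hbd _ hyU) (hcd _ hyU) t)
          (hprim _ hyO) hev (a A t) (a B t)
        have hfd : fderiv ℝ (fun z => b z + t • θ z) (Γ x τ) = fderiv ℝ b (Γ x τ) +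
            t • (fderiv ℝ c (Γ x τ) - fderiv ℝ b (Γ x τ)) :=
          ((hbd _ hyU).hasFDerivAt.add
            (((hcd _ hyU).hasFDerivAt.sub (hbd _ hyU).hasFDerivAt).const_smul t)).fderiv
        rw [hfd] at hid
        convert! h1 using 1
        rw [← hid]
        simp [hgτ, hθdef]
        ring
    have hA1 : ∀ A, a A 1 = fderiv ℝ Γ x A 1 := fun A => hat A 1
    have hg1 : g 1 = Γ x 1 := hgt 1
    have hA0 : ∀ A, a A 0 = A := fun A => by simp [ha, primitiveFun_zero]
    have hg0 : g 0 = x := by simp [hg, primitiveFun_zero]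
    rw [hA1, hA1, hA0, hA0, hg0, hg1] at key
    simp only [hθdef, one_smul, zero_smul, add_zero, add_sub_cancel] at key
    exact key
  · rw [he]
    exact hline _ (heO' hs).1 (heO' hs).2 (hαu s (hcO _ (heO' hs).2))
  · rw [he]
    exact hline _ (heO' hs).1 (heO' hs).2 (hαv s (hcO _ (heO' hs).2))

end Moser

/-! ### Linear symplectic normal form -/

section SymplecticLinearAlgebra

open Module

/-- `W` is the orthogonal complement of the plane of e and f; pairing x with f and e gives its
coefficients -s(f, x) and s(e, x). -/
theorem exists_hyperbolic_splitting {V : Type u} [AddCommGroup V] [Module ℝ V]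
    {s : V →ₗ[ℝ] V →ₗ[ℝ] ℝ} (halt : ∀ x y, s x y = - s y x) {e f : V} (hef : s e f = 1) :
    ∃ (W : Submodule ℝ V) (S : ((ℝ × ℝ) × W) ≃ₗ[ℝ] V),
      (∀ a b w, S ((a, b), w) = a • e + b • f + w) ∧ ∀ w ∈ W, s e w = 0 ∧ s f w = 0 := by
  have hfe : s f e = -1 := by rw [halt, hef]
  have hee : s e e = 0 := by have := halt e e; linarith
  have hff : s f f = 0 := by have := halt f f; linarith
  set W : Submodule ℝ V := LinearMap.ker (s e) ⊓ LinearMap.ker (s f) with hW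
  let T : ((ℝ × ℝ) × W) →ₗ[ℝ] V :=
    ((LinearMap.toSpanSingleton ℝ V e).coprod (LinearMap.toSpanSingleton ℝ V f)).coprod W.subtype
  have hT : ∀ a b w, T ((a, b), w) = a • e + b • f + w := fun a b w => rfl
  have hWs : ∀ w ∈ W, s e w = 0 ∧ s f w = 0 := fun w hw => hw
  refine ⟨W, LinearEquiv.ofBijective T ⟨?_, fun x => ?_⟩, hT, hWs⟩
  · rw [← LinearMap.ker_eq_bot, LinearMap.ker_eq_bot']
    rintro ⟨⟨a, b⟩, w⟩ h
    rw [hT] at h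
    obtain ⟨h1, h2⟩ := hWs w w.2
    have ha := congrArg (s f) h
    have hb := congrArg (s e) h
    simp only [map_add, map_smul, hee, hff, hfe, hef, h1, h2, smul_eq_mul, map_zero] at ha hb
    have ha' : a = 0 := by linarith
    have hb' : b = 0 := by linarith
    subst ha' hb'
    simp only [zero_smul, zero_add] at h
    have : w = 0 := Subtype.ext h
    rw [this]; rfl
  · refine ⟨((- s f x, s e x), ⟨x + s f x • e - s e x • f, ?_, ?_⟩), ?_⟩
    · simp [hee, hef]
    · simp [hff, hfe]
    · rw [hT]; simp only; module

/-- Two symplectic vector spaces of the same dimension are isomorphic, with any prescribed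
hyperbolic pairs corresponding to each other. -/
theorem exists_symplectic_equiv (d : ℕ) :
    ∀ {V : Type u} {V' : Type v} [AddCommGroup V] [Module ℝ V] [FiniteDimensional ℝ V]
      [AddCommGroup V'] [Module ℝ V'] [FiniteDimensional ℝ V']
      {s : V →ₗ[ℝ] V →ₗ[ℝ] ℝ} {s' : V' →ₗ[ℝ] V' →ₗ[ℝ] ℝ},
      finrank ℝ V = d → finrank ℝ V' = d →
      (∀ x y, s x y = - s y x) → (∀ x y, s' x y = - s' y x) →
      (∀ x, (∀ y, s x y = 0) → x = 0) → (∀ x, (∀ y, s' x y = 0) → x = 0) →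
      ∀ {e f : V} {e' f' : V'}, s e f = 1 → s' e' f' = 1 →
      ∃ A : V ≃ₗ[ℝ] V', A e = e' ∧ A f = f' ∧ ∀ x y, s' (A x) (A y) = s x y := by
  induction d using Nat.strong_induction_on with
  | _ d ih =>
  intro V V' _ _ _ _ _ _ s s' hd hd' halt halt' hnd hnd' e f e' f' hef hef'
  obtain ⟨W, S, hS, hW⟩ := exists_hyperbolic_splitting halt hef
  obtain ⟨W', S', hS', hW'⟩ := exists_hyperbolic_splitting halt' hef'
  have hdW : finrank ℝ W + 2 = d := by
    rw [← hd, ← S.finrank_eq, finrank_prod, finrank_prod, finrank_self]; omega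
  have hdW' : finrank ℝ W' + 2 = d := by
    rw [← hd', ← S'.finrank_eq, finrank_prod, finrank_prod, finrank_self]; omega
  have hfe : s f e = -1 := by rw [halt, hef]
  have hee : s e e = 0 := by have := halt e e; linarith
  have hff : s f f = 0 := by have := halt f f; linarith
  have hfe' : s' f' e' = -1 := by rw [halt', hef']
  have hee' : s' e' e' = 0 := by have := halt' e' e'; linarith
  have hff' : s' f' f' = 0 := by have := halt' f' f'; linarith
  have hsS : ∀ a b w c d z, s (S ((a, b), w)) (S ((c, d), z)) = a * d - b * c + s w z := by
    intro a b w c d z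
    obtain ⟨h1, h2⟩ := hW w w.2
    obtain ⟨h3, h4⟩ := hW z z.2
    rw [halt] at h1 h2
    have h1' : s w e = 0 := by linarith
    have h2' : s w f = 0 := by linarith
    simp only [hS, map_add, map_smul, LinearMap.add_apply, LinearMap.smul_apply, smul_eq_mul,
      hef, hfe, hee, hff, h3, h4, h1', h2']
    ring
  have hsS' : ∀ a b w c d z, s' (S' ((a, b), w)) (S' ((c, d), z)) = a * d - b * c + s' w z := by
    intro a b w c d z
    obtain ⟨h1, h2⟩ := hW' w w.2
    obtain ⟨h3, h4⟩ := hW' z z.2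
    rw [halt'] at h1 h2
    have h1' : s' w e' = 0 := by linarith
    have h2' : s' w f' = 0 := by linarith
    simp only [hS', map_add, map_smul, LinearMap.add_apply, LinearMap.smul_apply, smul_eq_mul,
      hef', hfe', hee', hff', h3, h4, h1', h2']
    ring
  have hndW : ∀ x : W, (∀ y : W, s x y = 0) → x = 0 := fun x hx => by
    refine Subtype.ext (hnd _ fun y => ?_)
    obtain ⟨⟨⟨c, d⟩, z⟩, rfl⟩ := S.surjective y
    have h1 := hsS 0 0 x c d z
    rw [hS 0 0 x, hx z] at h1
    simpa using h1
  have hndW' : ∀ x : W', (∀ y : W', s' x y = 0) → x = 0 := fun x hx => by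
    refine Subtype.ext (hnd' _ fun y => ?_)
    obtain ⟨⟨⟨c, d⟩, z⟩, rfl⟩ := S'.surjective y
    have h1 := hsS' 0 0 x c d z
    rw [hS' 0 0 x, hx z] at h1
    simpa using h1
  -- The complements are nondegenerate and two dimensions smaller. If they are nonzero, each
  -- contains some hyperbolic pair, and induction applies.
  obtain ⟨B, hB⟩ : ∃ B : W ≃ₗ[ℝ] W', ∀ x y : W, s' (B x) (B y) = s x y := by
    rcases Nat.eq_zero_or_pos (finrank ℝ W) with h0 | hpos
    · have h0' : finrank ℝ W' = 0 := by omega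
      refine ⟨LinearEquiv.ofFinrankEq _ _ (h0.trans h0'.symm), fun x y => ?_⟩
      have := finrank_zero_iff.1 h0
      rw [Subsingleton.elim x 0]; simp
    · have hyp : ∃ x y : W, s x y = 1 := by
        have := finrank_pos_iff.1 hpos
        obtain ⟨x, hx⟩ := exists_ne (0 : W)
        obtain ⟨y, hy⟩ := not_forall.1 (mt (hndW x) hx)
        exact ⟨x, (s x y)⁻¹ • y, by simp [inv_mul_cancel₀ hy]⟩
      have hyp' : ∃ x y : W', s' x y = 1 := by
        have := finrank_pos_iff.1 (by omega : 0 < finrank ℝ W')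
        obtain ⟨x, hx⟩ := exists_ne (0 : W')
        obtain ⟨y, hy⟩ := not_forall.1 (mt (hndW' x) hx)
        exact ⟨x, (s' x y)⁻¹ • y, by simp [inv_mul_cancel₀ hy]⟩
      obtain ⟨x, y, hxy⟩ := hyp
      obtain ⟨x', y', hxy'⟩ := hyp'
      obtain ⟨B, -, -, hB⟩ := ih (finrank ℝ W) (by omega) (s := s.domRestrict₁₂ W W)
        (s' := s'.domRestrict₁₂ W' W') rfl (by omega) (fun x y => halt x y) (fun x y => halt' x y)
        hndW hndW' hxy hxy'
      exact ⟨B, hB⟩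
  have heS : S ((1, 0), 0) = e := by rw [hS]; simp
  have hfS : S ((0, 1), 0) = f := by rw [hS]; simp
  refine ⟨(S.symm.trans ((LinearEquiv.refl ℝ (ℝ × ℝ)).prodCongr B)).trans S', ?_, ?_, ?_⟩
  · rw [← heS]; simp [hS']
  · rw [← hfS]; simp [hS']
  · intro x y
    obtain ⟨⟨⟨a, b⟩, w⟩, rfl⟩ := S.surjective x
    obtain ⟨⟨⟨c, d⟩, z⟩, rfl⟩ := S.surjective y
    simp only [LinearEquiv.trans_apply, LinearEquiv.symm_apply_apply, LinearEquiv.prodCongr_apply,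
      LinearEquiv.refl_apply]
    rw [hsS, hsS', hB]

end SymplecticLinearAlgebra

/-! ### 2-forms as bilinear forms, and their pull-backs -/

section Forms

variable {E : Type u} [NormedAddCommGroup E] [NormedSpace ℝ E]

variable (E) in
/-- An alternating 2-form as a continuous bilinear form. -/
noncomputable def formToBilin : E [⋀^Fin 2]→L[ℝ] ℝ →L[ℝ] E →L[ℝ] E →L[ℝ] ℝ :=
  (ContinuousLinearMap.compL ℝ E (E [⋀^Fin 1]→L[ℝ] ℝ) (E →L[ℝ] ℝ)
    ((ContinuousAlternatingMap.ofSubsingletonLIE (𝕜 := ℝ) (E := E) (F := ℝ)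
      (0 : Fin 1)).symm.toContinuousLinearEquiv :
        (E [⋀^Fin 1]→L[ℝ] ℝ) →L[ℝ] (E →L[ℝ] ℝ))).comp
    (ContinuousAlternatingMap.curryLeftLI (n := 1)).toContinuousLinearMap

theorem formToBilin_apply (s : E [⋀^Fin 2]→L[ℝ] ℝ) (u v : E) : formToBilin E s u v = s ![u, v] := by
  change s (Matrix.vecCons u fun _ => v) = _
  congr 1
  ext i; fin_cases i <;> rfl

theorem formToBilin_neg (s : E [⋀^Fin 2]→L[ℝ] ℝ) (u v : E) :
    formToBilin E s u v = - formToBilin E s v u := by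
  rw [formToBilin_apply, formToBilin_apply]
  have h := s.toAlternatingMap.map_swap ![v, u] (i := 0) (j := 1) (by decide)
  rw [← ContinuousAlternatingMap.coe_toAlternatingMap, ← h]
  congr 1
  ext i; fin_cases i <;> rfl

theorem formToBilin_injective : Function.Injective (formToBilin E) := fun s t h => by
  ext w
  have h1 : w = ![w 0, w 1] := by ext i; fin_cases i <;> rfl
  rw [h1, ← formToBilin_apply, ← formToBilin_apply, h]

theorem closedAt_formToBilin {β : E → E [⋀^Fin 2]→L[ℝ] ℝ} {x : E} (hβ : DifferentiableAt ℝ β x)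
    (h : extDeriv β x = 0) : ClosedAt (fun y => formToBilin E (β y)) x := by
  intro u v w
  have h1 : fderiv ℝ (fun y => formToBilin E (β y)) x = (formToBilin E).comp (fderiv ℝ β x) :=
    ((formToBilin E).hasFDerivAt.comp x hβ.hasFDerivAt).fderiv
  rw [h1]
  simp only [ContinuousLinearMap.comp_apply, formToBilin_apply]
  have h2 := congrArg (fun s => s ![u, v, w]) h
  simp only [extDeriv, ContinuousAlternatingMap.alternatizeUncurryFin_apply] at h2
  have r0 : (0 : Fin 3).removeNth ![u, v, w] = ![v, w] := by ext i; fin_cases i <;> rfl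
  have r1 : (1 : Fin 3).removeNth ![u, v, w] = ![u, w] := by ext i; fin_cases i <;> rfl
  have r2 : (2 : Fin 3).removeNth ![u, v, w] = ![u, v] := by ext i; fin_cases i <;> rfl
  have h3 := (Fin.sum_univ_three fun i : Fin 3 => (-1 : ℤ) ^ (i : ℕ) •
    fderiv ℝ β x (![u, v, w] i) (i.removeNth ![u, v, w])).symm.trans h2
  rw [r0, r1, r2] at h3
  simp at h3
  linarith

/-- The pull-back of a 2-form under a map. -/
noncomputable def pullbackForm (β : E → E [⋀^Fin 2]→L[ℝ] ℝ) (f : E → E) (x : E) :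
    E [⋀^Fin 2]→L[ℝ] ℝ :=
  (β (f x)).compContinuousLinearMap (fderiv ℝ f x)

theorem formToBilin_pullbackForm (β : E → E [⋀^Fin 2]→L[ℝ] ℝ) (f : E → E) (x u v : E) :
    formToBilin E (pullbackForm β f x) u v =
      formToBilin E (β (f x)) (fderiv ℝ f x u) (fderiv ℝ f x v) := by
  rw [formToBilin_apply, formToBilin_apply, pullbackForm,
    ContinuousAlternatingMap.compContinuousLinearMap_apply]
  congr 1
  ext i; fin_cases i <;> rfl

/-- As a map from `E` to its dual, the pull-back is the form composed with Df on one side and its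
transpose on the other. Df costs a derivative, hence `r + 1 ≤ r`. -/
theorem contDiffOn_formToBilin_pullbackForm {r : WithTop ℕ∞} (hr : r + 1 ≤ r) {O U : Set E}
    (hO : IsOpen O) {β : E → E [⋀^Fin 2]→L[ℝ] ℝ} (hβ : ContDiffOn ℝ r β U) {f : E → E}
    (hf : ContDiffOn ℝ r f O) (hfO : Set.MapsTo f O U) :
    ContDiffOn ℝ r (fun x => formToBilin E (pullbackForm β f x)) O := by
  have hD : ContDiffOn ℝ r (fderiv ℝ f) O := hf.fderiv_of_isOpen hO hr
  have hT : ContDiffOn ℝ r (fun x => formToBilin E (β (f x))) O :=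
    (formToBilin E).contDiff.comp_contDiffOn (hβ.comp hf hfO)
  have h1 : ContDiffOn ℝ r (fun x => (ContinuousLinearMap.compL ℝ E E ℝ).flip (fderiv ℝ f x)) O :=
    (ContinuousLinearMap.compL ℝ E E ℝ).flip.contDiff.comp_contDiffOn hD
  refine (h1.clm_comp (hT.clm_comp hD)).congr fun x _ => ?_
  ext u v
  rw [formToBilin_pullbackForm]; rfl

theorem closedAt_formToBilin_pullbackForm {r : WithTop ℕ∞} (hr : 2 ≤ r) {x : E}
    {β : E → E [⋀^Fin 2]→L[ℝ] ℝ} {f : E → E} (hf : ContDiffAt ℝ r f x)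
    (hβ : DifferentiableAt ℝ β (f x)) (hcl : extDeriv β (f x) = 0) :
    ClosedAt (fun y => formToBilin E (pullbackForm β f y)) x := by
  have hr0 : r ≠ 0 := fun h => by simp [h] at hr
  have hfd := hf.differentiableAt hr0
  have hfd2 : DifferentiableAt ℝ (fderiv ℝ f) x :=
    (hf.fderiv_right (m := 1) (by simpa [one_add_one_eq_two] using hr)).differentiableAt one_ne_zero
  refine closedAt_formToBilin ?_ ?_
  · exact DifferentiableAt.continuousAlternatingMapCompContinuousLinearMap (hβ.comp x hfd) hfd2
  · have := extDeriv_pullback hβ hf (by simpa using hr)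
    rw [hcl] at this
    refine this.trans ?_
    ext; simp

end Forms

/-! ### Straightening two transversal curves -/

section CurveGerms

variable {E : Type u} [NormedAddCommGroup E] [NormedSpace ℝ E]

/-- Near `y`, the set `S` is a curve of class `C^r` with velocity `u` at `y`. -/
def IsCurveGerm (r : WithTop ℕ∞) (S : Set E) (y u : E) : Prop :=
  ∃ (c : ℝ → E) (T : Set ℝ), IsOpen T ∧ 0 ∈ T ∧ ContDiffOn ℝ r c T ∧ c 0 = y ∧ HasDerivAt c u 0 ∧
    (∀ t ∈ T, c t ∈ S) ∧ ∀ T' ∈ 𝓝 (0 : ℝ), ∀ᶠ z in 𝓝 y, z ∈ S → ∃ t ∈ T', c t = z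

/-- The curve is the preimage of a straight line. Points of `S` near y have small parameters because
|t|‖w‖ = ‖χ z - χ y‖ with w ≠ 0. -/
theorem isCurveGerm_of_chart {r : WithTop ℕ∞} (hr : r ≠ 0) (χ : OpenPartialHomeomorph E E)
    (hχ : ContDiffOn ℝ r χ.symm χ.target) {S : Set E} {y w : E}
    (hy : y ∈ χ.source) (hw : w ≠ 0)
    (hS : ∀ z ∈ χ.source, z ∈ S ↔ ∃ t : ℝ, χ z = χ y + t • w) :
    IsCurveGerm r S y (fderiv ℝ χ.symm (χ y) w) := by
  have hyt := χ.map_source hy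
  have hcont : Continuous fun t : ℝ => χ y + t • w := by fun_prop
  have hcd : ContDiff ℝ r fun t : ℝ => χ y + t • w := by fun_prop
  have hd : HasDerivAt (fun t : ℝ => χ y + t • w) w 0 := by
    simpa using ((hasDerivAt_id (0 : ℝ)).smul_const w).const_add (χ y)
  refine ⟨fun t => χ.symm (χ y + t • w), (fun t : ℝ => χ y + t • w) ⁻¹' χ.target,
    χ.open_target.preimage hcont, by simpa using hyt, hχ.comp hcd.contDiffOn fun t ht => ht,
    by simp [χ.left_inv hy], ?_, fun t ht => ?_, fun T' hT' => ?_⟩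
  · have h1 := ((hχ.contDiffAt (χ.open_target.mem_nhds hyt)).differentiableAt hr).hasFDerivAt
    have h2 : χ y = χ y + (0 : ℝ) • w := by simp
    rw [h2] at h1
    have := h1.comp_hasDerivAt (0 : ℝ) hd
    rw [← h2] at this
    exact this
  · exact (hS _ (χ.map_target ht)).2 ⟨t, χ.right_inv ht⟩
  · obtain ⟨ε, hε, hT'ε⟩ := Metric.mem_nhds_iff.1 hT'
    have hwpos : 0 < ‖w‖ := norm_pos_iff.2 hw
    have h1 : ∀ᶠ z in 𝓝 y, ‖χ z - χ y‖ < ε * ‖w‖ := by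
      have h2 : ContinuousAt (fun z => ‖χ z - χ y‖) y :=
        ((χ.continuousAt hy).sub continuousAt_const).norm
      refine h2.eventually_lt continuousAt_const ?_
      simp only [sub_self, norm_zero]; positivity
    filter_upwards [h1, χ.open_source.mem_nhds hy] with z hz hzs hzS
    obtain ⟨t, ht⟩ := (hS z hzs).1 hzS
    refine ⟨t, hT'ε ?_, ?_⟩
    · rw [ht, add_sub_cancel_left, norm_smul] at hz
      simpa using lt_of_mul_lt_mul_right hz hwpos.le
    · rw [← ht, χ.left_inv hzs]

/-- Two transversal curves are simultaneously straightened by a local diffeomorphism with identity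
differential. -/
theorem exists_straightening [CompleteSpace E] {r : WithTop ℕ∞} (hr : 1 ≤ r) {U : Set E}
    (hU : IsOpen U) {y u v : E} (hy : y ∈ U) {S₁ S₂ : Set E} (h₁ : IsCurveGerm r S₁ y u)
    (h₂ : IsCurveGerm r S₂ y v) {l m : E →L[ℝ] ℝ}
    (hlu : l u = 1) (hlv : l v = 0) (hmu : m u = 0) (hmv : m v = 1) :
    ∃ e : OpenPartialHomeomorph E E, 0 ∈ e.source ∧ e 0 = y ∧ e.target ⊆ U ∧
      ContDiffOn ℝ r e e.source ∧ ContDiffOn ℝ r e.symm e.target ∧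
      fderiv ℝ e 0 = ContinuousLinearMap.id ℝ E ∧
      ∀ x ∈ e.source, (e x ∈ S₁ ↔ ∃ s : ℝ, x = s • u) ∧ (e x ∈ S₂ ↔ ∃ s : ℝ, x = s • v) := by
  obtain ⟨c₁, T₁, hT₁, h0T₁, hc₁, hc₁0, hc₁d, hc₁S, hc₁n⟩ := h₁
  obtain ⟨c₂, T₂, hT₂, h0T₂, hc₂, hc₂0, hc₂d, hc₂S, hc₂n⟩ := h₂
  set O : Set E := l ⁻¹' T₁ ∩ m ⁻¹' T₂ with hO
  have hOo : IsOpen O := (hT₁.preimage l.continuous).inter (hT₂.preimage m.continuous)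
  have h0O : (0 : E) ∈ O := by simp [hO, h0T₁, h0T₂]
  -- On each line this map is the corresponding curve, and both corrections have zero derivative at
  -- 0.
  set G : E → E := fun x => x + (c₁ (l x) - l x • u) + (c₂ (m x) - m x • v) - y with hG
  have hGc : ContDiffOn ℝ r G O := by
    refine ((contDiffOn_id.add ?_).add ?_).sub contDiffOn_const
    · exact (hc₁.comp l.contDiff.contDiffOn fun x hx => hx.1).sub
        (l.contDiff.smul contDiff_const).contDiffOn
    · exact (hc₂.comp m.contDiff.contDiffOn fun x hx => hx.2).sub
        (m.contDiff.smul contDiff_const).contDiffOn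
  have hGd : HasFDerivAt G ((ContinuousLinearEquiv.refl ℝ E : E ≃L[ℝ] E) : E →L[ℝ] E) 0 := by
    have d₁ : HasFDerivAt (fun x => c₁ (l x)) (l.smulRight u) 0 := by
      have h : HasDerivAt c₁ u (l 0) := by rwa [map_zero]
      convert! h.hasFDerivAt.comp (0 : E) l.hasFDerivAt using 1
    have d₂ : HasFDerivAt (fun x => c₂ (m x)) (m.smulRight v) 0 := by
      have h : HasDerivAt c₂ v (m 0) := by rwa [map_zero]
      convert! h.hasFDerivAt.comp (0 : E) m.hasFDerivAt using 1
    have h := (((hasFDerivAt_id (0 : E)).add (d₁.sub (l.smulRight u).hasFDerivAt)).add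
      (d₂.sub (m.smulRight v).hasFDerivAt)).sub_const y
    convert! h using 1
    ext x; simp
  have hG0 : G 0 = y := by simp [hG, hc₁0, hc₂0]
  have hGu : ∀ s, G (s • u) = c₁ s := fun s => by simp [hG, hlu, hmu, hc₂0]
  have hGv : ∀ s, G (s • v) = c₂ s := fun s => by simp [hG, hlv, hmv, hc₁0]; abel
  obtain ⟨e, he, he0, heO, hes⟩ := hGc.exists_openPartialHomeomorph hr hOo h0O hGd
  have hT' : ∀ z : E, {s : ℝ | s • z ∈ e.source} ∈ 𝓝 (0 : ℝ) := fun z => by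
    have hc : Continuous fun s : ℝ => s • z := by fun_prop
    exact (e.open_source.preimage hc).mem_nhds (by simpa using he0)
  -- In Ω, each point of either curve has a parameter s whose point on the line lies in `e.source`;
  -- injectivity of `e` then shows that only points of the lines are sent to the curves.
  obtain ⟨Ω, hΩ, hΩo, hyΩ⟩ := eventually_nhds_iff.1
    (((hc₁n _ (hT' u)).and (hc₂n _ (hT' v))).and (hU.mem_nhds hy))
  refine ⟨e.trans (OpenPartialHomeomorph.ofSet Ω hΩo), ?_, ?_, ?_, ?_, ?_, ?_, ?_⟩
  · simp [he0, he, hG0, hyΩ]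
  · simp [he, hG0]
  · intro z hz
    simp only [OpenPartialHomeomorph.trans_target, OpenPartialHomeomorph.ofSet_target] at hz
    exact (hΩ z hz.1).2
  · have : (e.trans (OpenPartialHomeomorph.ofSet Ω hΩo) : E → E) = G := by ext x; simp [he]
    rw [this]
    exact hGc.mono fun x hx => heO hx.1
  · refine (hes.mono fun z hz => ?_).congr fun z hz => ?_
    · exact hz.2
    · simp
  · have : (e.trans (OpenPartialHomeomorph.ofSet Ω hΩo) : E → E) = G := by ext x; simp [he]
    rw [this, hGd.fderiv]; rfl
  · intro x hx
    have hxe : x ∈ e.source := hx.1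
    have hxΩ : e x ∈ Ω := hx.2
    have hx' : (e.trans (OpenPartialHomeomorph.ofSet Ω hΩo)) x = G x := by simp [he]
    rw [he] at hxΩ
    rw [hx']
    refine ⟨⟨fun h => ?_, ?_⟩, ⟨fun h => ?_, ?_⟩⟩
    · obtain ⟨s, hs, hsx⟩ := (hΩ _ hxΩ).1.1 h
      exact ⟨s, e.injOn hxe hs (by rw [he, hGu, hsx])⟩
    · rintro ⟨s, rfl⟩
      rw [hGu]
      have := (heO hxe).1
      exact hc₁S s (by simpa [hlu] using this)
    · obtain ⟨s, hs, hsx⟩ := (hΩ _ hxΩ).1.2 h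
      exact ⟨s, e.injOn hxe hs (by rw [he, hGv, hsx])⟩
    · rintro ⟨s, rfl⟩
      rw [hGv]
      have := (heO hxe).2
      exact hc₂S s (by simpa [hmv] using this)

end CurveGerms

/-! ### Local equivalence of symplectic crosses in a vector space -/

section LocalEquivalence

variable {E : Type u} [NormedAddCommGroup E] [NormedSpace ℝ E]

/-- Near `y`, a closed 2-form `β` that is nondegenerate at `y`, with two curves whose velocities
`u`, `v` at `y` satisfy `β (u, v) ≠ 0`. -/
structure IsSymplecticCross (r : WithTop ℕ∞) (U : Set E) (β : E → E [⋀^Fin 2]→L[ℝ] ℝ)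
    (S₁ S₂ : Set E) (y u v : E) : Prop where
  isOpen : IsOpen U
  mem : y ∈ U
  contDiffOn : ContDiffOn ℝ r β U
  closed : ∀ x ∈ U, extDeriv β x = 0
  nondegenerate : ∀ x, (∀ z, β y ![x, z] = 0) → x = 0
  curve₁ : IsCurveGerm r S₁ y u
  curve₂ : IsCurveGerm r S₂ y v
  ne_zero : β y ![u, v] ≠ 0

/-- The point `x` lies on one of the lines spanned by `u` and `v`. -/
def OnCross (u v x : E) : Prop := (∃ s : ℝ, x = s • u) ∨ ∃ s : ℝ, x = s • v

theorem onCross_smul_right (u v x : E) {k : ℝ} (hk : k ≠ 0) : OnCross u (k • v) x ↔ OnCross u v x := by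
  refine or_congr Iff.rfl ⟨?_, ?_⟩
  · rintro ⟨s, rfl⟩
    exact ⟨s * k, by rw [mul_smul]⟩
  · rintro ⟨s, rfl⟩
    exact ⟨s * k⁻¹, by rw [smul_smul, mul_assoc, inv_mul_cancel₀ hk, mul_one]⟩

theorem onCross_map_iff (A : E ≃L[ℝ] E) (u v x : E) : OnCross (A u) (A v) (A x) ↔ OnCross u v x := by
  simp only [OnCross, ← map_smul, A.injective.eq_iff]

/-- The form itself supplies the functionals: b(·, v) and b(u, ·), divided by b(u, v). -/
theorem exists_dual_pair {b : E →L[ℝ] E →L[ℝ] ℝ} (halt : ∀ x z, b x z = - b z x) {u v : E}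
    (h : b u v ≠ 0) : ∃ l m : E →L[ℝ] ℝ, l u = 1 ∧ l v = 0 ∧ m u = 0 ∧ m v = 1 := by
  have huu : b u u = 0 := by have := halt u u; linarith
  have hvv : b v v = 0 := by have := halt v v; linarith
  exact ⟨(b u v)⁻¹ • b.flip v, (b u v)⁻¹ • b u, by simp [h], by simp [hvv], by simp [huu],
    by simp [h]⟩

theorem IsSymplecticCross.exists_straightening [CompleteSpace E] {r : WithTop ℕ∞} (hr : 1 ≤ r)
    {U : Set E} {β : E → E [⋀^Fin 2]→L[ℝ] ℝ} {S₁ S₂ : Set E} {y u v : E}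
    (h : IsSymplecticCross r U β S₁ S₂ y u v) :
    ∃ e : OpenPartialHomeomorph E E, 0 ∈ e.source ∧ e 0 = y ∧ e.target ⊆ U ∧
      ContDiffOn ℝ r e e.source ∧ ContDiffOn ℝ r e.symm e.target ∧
      fderiv ℝ e 0 = ContinuousLinearMap.id ℝ E ∧
      ∀ x ∈ e.source, e x ∈ S₁ ∪ S₂ ↔ OnCross u v x := by
  have hne := h.ne_zero
  rw [← formToBilin_apply] at hne
  obtain ⟨l, m, hlu, hlv, hmu, hmv⟩ := exists_dual_pair (formToBilin_neg (β y)) hne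
  obtain ⟨e, h0, hy, ht, hc, hcs, hd, hS⟩ :=
    _root_.exists_straightening hr h.isOpen h.mem h.curve₁ h.curve₂ hlu hlv hmu hmv
  exact ⟨e, h0, hy, ht, hc, hcs, hd, fun x hx => or_congr (hS x hx).1 (hS x hx).2⟩

theorem fderiv_comp_fderiv_symm {r : WithTop ℕ∞} (hr : r ≠ 0) (e : OpenPartialHomeomorph E E)
    (he : ContDiffOn ℝ r e e.source) (hes : ContDiffOn ℝ r e.symm e.target) {y : E}
    (hy : y ∈ e.target) :
    (fderiv ℝ e (e.symm y)).comp (fderiv ℝ e.symm y) = ContinuousLinearMap.id ℝ E := by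
  have h1 := ((he.contDiffAt (e.open_source.mem_nhds (e.map_target hy))).differentiableAt
    hr).hasFDerivAt
  have h2 := ((hes.contDiffAt (e.open_target.mem_nhds hy)).differentiableAt hr).hasFDerivAt
  have h3 : e ∘ e.symm =ᶠ[𝓝 y] id := by
    filter_upwards [e.open_target.mem_nhds hy] with z hz using e.right_inv hz
  exact (h1.comp y h2).unique ((hasFDerivAt_id y).congr_of_eventuallyEq h3)

/-- Two symplectic crosses of the same dimension are locally equivalent. -/
theorem IsSymplecticCross.exists_equivalence [FiniteDimensional ℝ E] {r : WithTop ℕ∞}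
    (hr : r = ∞ ∨ r = ω) {U U' : Set E} {β β' : E → E [⋀^Fin 2]→L[ℝ] ℝ}
    {S₁ S₂ S₁' S₂' : Set E} {y y' u v u' v' : E}
    (h : IsSymplecticCross r U β S₁ S₂ y u v) (h' : IsSymplecticCross r U' β' S₁' S₂' y' u' v') :
    ∃ f : OpenPartialHomeomorph E E, y ∈ f.source ∧ f y = y' ∧ f.source ⊆ U ∧ f.target ⊆ U' ∧
      ContDiffOn ℝ r f f.source ∧ ContDiffOn ℝ r f.symm f.target ∧
      (∀ x ∈ f.source, pullbackForm β' f x = β x) ∧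
      ∀ x ∈ f.source, f x ∈ S₁' ∪ S₂' ↔ x ∈ S₁ ∪ S₂ := by
  have : CompleteSpace E := FiniteDimensional.complete ℝ E
  have hr2 : (2 : WithTop ℕ∞) ≤ r := by
    rcases hr with rfl | rfl
    · exact WithTop.coe_le_coe.2 (le_top : (2 : ℕ∞) ≤ ⊤)
    · exact le_top
  have hr1 : (1 : WithTop ℕ∞) ≤ r := by rcases hr with rfl | rfl <;> simp
  have hrr : r + 1 ≤ r := by rcases hr with rfl | rfl <;> simp
  have hr0 : r ≠ 0 := fun h => by simp [h] at hr1
  obtain ⟨G, hG0, hGy, hGt, hG, hGs, hGd, hGS⟩ := h.exists_straightening hr1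
  obtain ⟨G', hG0', hGy', hGt', hG', hGs', hGd', hGS'⟩ := h'.exists_straightening hr1
  set k := β y ![u, v] with hk
  set k' := β' y' ![u', v'] with hk'
  have hk0 : k ≠ 0 := h.ne_zero
  have hk0' : k' ≠ 0 := h'.ne_zero
  -- Dividing by k and k' makes both pairs hyperbolic; only the lines matter, so the scaling is
  -- harmless.
  obtain ⟨A, hAu, hAv, hA⟩ : ∃ A : E ≃L[ℝ] E, A u = u' ∧ A (k⁻¹ • v) = k'⁻¹ • v' ∧
      ∀ x z, formToBilin E (β' y') (A x) (A z) = formToBilin E (β y) x z := by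
    obtain ⟨A, h1, h2, h3⟩ := exists_symplectic_equiv (Module.finrank ℝ E)
      (s := (ContinuousLinearMap.coeLM ℝ).comp (formToBilin E (β y)).toLinearMap)
      (s' := (ContinuousLinearMap.coeLM ℝ).comp (formToBilin E (β' y')).toLinearMap)
      rfl rfl (formToBilin_neg _) (formToBilin_neg _)
      (fun x hx => h.nondegenerate x fun z => by rw [← formToBilin_apply]; exact hx z)
      (fun x hx => h'.nondegenerate x fun z => by rw [← formToBilin_apply]; exact hx z)
      (e := u) (f := k⁻¹ • v) (e' := u') (f' := k'⁻¹ • v')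
      (by
        change formToBilin E (β y) u (k⁻¹ • v) = 1
        rw [map_smul, formToBilin_apply, smul_eq_mul, inv_mul_cancel₀ hk0])
      (by
        change formToBilin E (β' y') u' (k'⁻¹ • v') = 1
        rw [map_smul, formToBilin_apply, smul_eq_mul, inv_mul_cancel₀ hk0'])
    exact ⟨A.toContinuousLinearEquiv, h1, h2, h3⟩
  -- With `A` inserted, `G` and `H` straighten the two configurations to the same lines, and the
  -- pulled-back forms agree at 0.
  set H : OpenPartialHomeomorph E E := A.toHomeomorph.toOpenPartialHomeomorph.trans G' with hH
  have hHcoe : (H : E → E) = G' ∘ A := rfl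
  have hHsrc : H.source = A ⁻¹' G'.source := by ext; simp [hH]
  have hHtgt : H.target = G'.target := by simp [hH]
  have hHc : ContDiffOn ℝ r H H.source := by
    rw [hHcoe]
    exact hG'.comp A.contDiff.contDiffOn fun x hx => by rwa [hHsrc] at hx
  have hHs : ContDiffOn ℝ r H.symm H.target := by
    have : (H.symm : E → E) = A.symm ∘ G'.symm := rfl
    rw [this, hHtgt]
    exact A.symm.contDiff.comp_contDiffOn hGs'
  have hH0 : 0 ∈ H.source := by simpa [hHsrc] using hG0'
  have hHy : H 0 = y' := by simp [hHcoe, hGy']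
  have hHd : fderiv ℝ H 0 = A := by
    have h1 : HasFDerivAt G' (fderiv ℝ G' 0) (A 0) := by
      rw [map_zero]
      exact ((hG'.contDiffAt (G'.open_source.mem_nhds hG0')).differentiableAt hr0).hasFDerivAt
    have h2 := (h1.comp (0 : E) A.hasFDerivAt).fderiv
    rw [hHcoe, h2, hGd']; rfl
  have hHS : ∀ x ∈ H.source, H x ∈ S₁' ∪ S₂' ↔ OnCross u v x := fun x hx => by
    rw [hHsrc] at hx
    rw [hHcoe, Function.comp_apply, hGS' _ hx, ← onCross_smul_right u' v' _ (inv_ne_zero hk0'),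
      ← hAu, ← hAv, onCross_map_iff, onCross_smul_right u v _ (inv_ne_zero hk0)]
  have hform : ∀ {V : Set E} {γ : E → E [⋀^Fin 2]→L[ℝ] ℝ} (K : OpenPartialHomeomorph E E),
      IsOpen V → ContDiffOn ℝ r γ V → (∀ x ∈ V, extDeriv γ x = 0) → K.target ⊆ V →
      ContDiffOn ℝ r K K.source →
      ContDiffOn ℝ r (fun x => formToBilin E (pullbackForm γ K x)) K.source ∧
      ∀ x ∈ K.source, ClosedAt (fun x => formToBilin E (pullbackForm γ K x)) x := by
    intro V γ K hV hγ hcl hKV hK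
    have hmaps : Set.MapsTo K K.source V := fun x hx => hKV (K.map_source hx)
    refine ⟨contDiffOn_formToBilin_pullbackForm hrr K.open_source hγ hK hmaps, fun x hx => ?_⟩
    exact closedAt_formToBilin_pullbackForm hr2 (hK.contDiffAt (K.open_source.mem_nhds hx))
      ((hγ.contDiffAt (hV.mem_nhds (hmaps hx))).differentiableAt hr0) (hcl _ (hmaps hx))
  obtain ⟨hbc, hbcl⟩ := hform G h.isOpen h.contDiffOn h.closed hGt hG
  obtain ⟨hcc, hccl⟩ := hform H h'.isOpen h'.contDiffOn h'.closed (hHtgt ▸ hGt') hHc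
  set b := fun x => formToBilin E (pullbackForm β G x) with hb
  set c := fun x => formToBilin E (pullbackForm β' H x) with hc
  have hb0 : b 0 = formToBilin E (β y) := by
    ext x z
    simp only [hb, formToBilin_pullbackForm, hGd, hGy]; rfl
  have hc0 : c 0 = b 0 := by
    ext x z
    rw [hb0, ← hA]
    simp only [hc, formToBilin_pullbackForm, hHd, hHy]; rfl
  have hbinv : (b 0).IsInvertible := by
    rw [hb0]
    have hinj : LinearMap.ker (formToBilin E (β y) : E →ₗ[ℝ] E →L[ℝ] ℝ) = ⊥ := by
      rw [LinearMap.ker_eq_bot']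
      exact fun x hx => h.nondegenerate x fun z => by
        rw [← formToBilin_apply]
        exact congrArg (fun L : E →L[ℝ] ℝ => L z) hx
    have hdim : Module.finrank ℝ E = Module.finrank ℝ (E →L[ℝ] ℝ) := by
      rw [← (LinearMap.toContinuousLinearMap (𝕜 := ℝ) (E := E) (F' := ℝ)).finrank_eq]
      exact (Subspace.dual_finrank_eq (K := ℝ) (V := E)).symm
    exact ⟨(LinearEquiv.ofInjectiveOfFinrankEq (formToBilin E (β y)).toLinearMap
      (LinearMap.ker_eq_bot.1 hinj) hdim).toContinuousLinearEquiv, by ext; rfl⟩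
  have hne := h.ne_zero
  rw [← formToBilin_apply] at hne
  obtain ⟨l, m, hlu, hlv, hmu, hmv⟩ := exists_dual_pair (formToBilin_neg (β y)) hne
  obtain ⟨e, he0, he00, hes, het, hec, hecs, hepull, heu, hev⟩ := exists_moser hr
    (G.open_source.inter H.open_source) ⟨hG0, hH0⟩ (hbc.mono Set.inter_subset_left)
    (hcc.mono Set.inter_subset_right) (fun x _ => formToBilin_neg _) (fun x _ => formToBilin_neg _)
    (fun x hx => hbcl x hx.1) (fun x hx => hccl x hx.2) hc0 hbinv hlu hlv hmu hmv
  have hecross : ∀ x ∈ e.source, OnCross u v x → e x = x := by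
    rintro x hx (⟨s, rfl⟩ | ⟨s, rfl⟩)
    · exact heu s hx
    · exact hev s hx
  -- `e` fixes the cross points of its source, but might send other points onto the cross outside
  -- that source. Keeping only x with `e x` in the source excludes this: if `e x` is on the cross,
  -- then e(e x) = e x, and injectivity gives e x = x.
  set e₁ := e.trans (OpenPartialHomeomorph.ofSet e.source e.open_source) with he₁
  have he₁coe : ∀ x, e₁ x = e x := fun x => rfl
  have he₁src : ∀ x ∈ e₁.source, x ∈ e.source ∧ e x ∈ e.source := fun x hx => hx
  have he₁tgt : ∀ x ∈ e₁.target, x ∈ e.target := fun x hx => hx.2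
  have he₁symm : ∀ x, e₁.symm x = e.symm x := fun x => rfl
  have he₁S : ∀ x ∈ e₁.source, OnCross u v (e x) ↔ OnCross u v x := fun x hx => by
    obtain ⟨h1, h2⟩ := he₁src x hx
    constructor
    · intro h3
      have h4 := hecross _ h2 h3
      rwa [e.injOn h2 h1 h4] at h3
    · intro h3
      rwa [hecross _ h1 h3]
  set f := G.symm.trans (e₁.trans H) with hf
  have hfcoe : (f : E → E) = H ∘ e ∘ G.symm := rfl
  have hfsymm : (f.symm : E → E) = G ∘ e.symm ∘ H.symm := rfl
  have hfsrc : ∀ x ∈ f.source, x ∈ G.target ∧ G.symm x ∈ e₁.source ∧ e (G.symm x) ∈ H.source :=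
    fun x hx => ⟨hx.1, hx.2.1, hx.2.2⟩
  have hftgt : ∀ x ∈ f.target, x ∈ H.target ∧ H.symm x ∈ e.target ∧
      e.symm (H.symm x) ∈ G.source := fun x hx => by
    have h1 := f.map_target hx
    obtain ⟨h2, h3, h4⟩ := hfsrc _ h1
    have h5 := f.right_inv hx
    have h6 : H.symm x = e (G.symm (f.symm x)) := by
      conv_lhs => rw [← h5, hfcoe]
      exact H.left_inv h4
    have h7 : H.symm x ∈ e.target := by rw [h6]; exact e.map_source (he₁src _ h3).1
    refine ⟨?_, h7, (hes (e.map_target h7)).1⟩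
    rw [← h5, hfcoe]
    exact H.map_source h4
  refine ⟨f, ?_, ?_, fun x hx => hGt (hfsrc x hx).1, fun x hx => ?_, ?_, ?_, fun x hx => ?_,
    fun x hx => ?_⟩
  · have h1 : G.symm y = 0 := by rw [← hGy, G.left_inv hG0]
    refine ⟨by rw [← hGy]; exact G.map_source hG0, ?_⟩
    change G.symm y ∈ (e₁.trans H).source
    rw [h1]
    exact ⟨⟨he0, by change e 0 ∈ e.source; rwa [he00]⟩, by change e 0 ∈ H.source; rwa [he00]⟩
  · have h1 : G.symm y = 0 := by rw [← hGy, G.left_inv hG0]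
    simp [hfcoe, h1, he00, hHy]
  · exact hGt' (hHtgt ▸ (hftgt x hx).1)
  · rw [hfcoe]
    exact hHc.comp (hec.comp (hGs.mono fun x hx => (hfsrc x hx).1)
      fun x hx => (he₁src _ (hfsrc x hx).2.1).1) fun x hx => (hfsrc x hx).2.2
  · rw [hfsymm]
    exact hG.comp (hecs.comp (hHs.mono fun x hx => (hftgt x hx).1)
      fun x hx => (hftgt x hx).2.1) fun x hx => (hftgt x hx).2.2
  · obtain ⟨h1, h2, h3⟩ := hfsrc x hx
    have h2' := (he₁src _ h2).1
    have hdG := ((hGs.contDiffAt (G.open_target.mem_nhds h1)).differentiableAt hr0).hasFDerivAt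
    have hde := ((hec.contDiffAt (e.open_source.mem_nhds h2')).differentiableAt hr0).hasFDerivAt
    have hdH := ((hHc.contDiffAt (H.open_source.mem_nhds h3)).differentiableAt hr0).hasFDerivAt
    have hdf : fderiv ℝ f x = (fderiv ℝ H (e (G.symm x))).comp
        ((fderiv ℝ e (G.symm x)).comp (fderiv ℝ G.symm x)) :=
      (HasFDerivAt.comp (f := e ∘ G.symm) x hdH (hde.comp x hdG)).fderiv
    refine formToBilin_injective ?_
    ext w z
    rw [formToBilin_pullbackForm, hdf]
    have h4 := hepull _ h2' (fderiv ℝ G.symm x w) (fderiv ℝ G.symm x z)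
    simp only [hb, hc, formToBilin_pullbackForm] at h4
    have h5 := fderiv_comp_fderiv_symm hr0 G hG hGs h1
    have h6 : ∀ a, fderiv ℝ G (G.symm x) (fderiv ℝ G.symm x a) = a := fun a =>
      congrArg (fun L : E →L[ℝ] E => L a) h5
    rw [h6, h6, G.right_inv h1] at h4
    exact h4
  · obtain ⟨h1, h2, h3⟩ := hfsrc x hx
    rw [hfcoe, Function.comp_apply, Function.comp_apply, hHS _ h3, he₁S _ h2,
      ← hGS _ (G.map_target h1), G.right_inv h1]

end LocalEquivalence

/-! ### Reading the geometric data in a chart -/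

section Charts

variable {r : WithTop ℕ∞} {n : ℕ} {M : Type*} [TopologicalSpace M]
  [ChartedSpace (EuclideanSpace ℝ (Fin (2 * n))) M]

/-- The part of `S` in the domain of the chart `φ`, in coordinates. -/
def setInChart (φ : OpenPartialHomeomorph M (EuclideanSpace ℝ (Fin (2 * n)))) (S : Set M) :
    Set (EuclideanSpace ℝ (Fin (2 * n))) :=
  φ.target ∩ φ.symm ⁻¹' S

theorem mem_setInChart_iff {φ : OpenPartialHomeomorph M (EuclideanSpace ℝ (Fin (2 * n)))}
    {S : Set M} {q : M} (hq : q ∈ φ.source) : φ q ∈ setInChart φ S ↔ q ∈ S := by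
  simp [setInChart, φ.map_source hq, φ.left_inv hq]

theorem setInChart_union (φ : OpenPartialHomeomorph M (EuclideanSpace ℝ (Fin (2 * n))))
    (S T : Set M) : setInChart φ (S ∪ T) = setInChart φ S ∪ setInChart φ T := by
  simp [setInChart, Set.inter_union_distrib_left]

/-- The tangent space depends on the point, which obstructs rewriting; with the vectors typed in the
model space the base point can be replaced. -/
theorem form_congr (σ : ∀ q : M, TangentSpace (𝓡 (2 * n)) q [⋀^Fin 2]→L[ℝ] ℝ) {q q' : M}
    (h : q' = q) (a b : EuclideanSpace ℝ (Fin (2 * n))) :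
    σ q' (![a, b] : Fin 2 → EuclideanSpace ℝ (Fin (2 * n))) =
      σ q (![a, b] : Fin 2 → EuclideanSpace ℝ (Fin (2 * n))) := by
  subst h; rfl

theorem formInChart_apply (σ : ∀ q : M, TangentSpace (𝓡 (2 * n)) q [⋀^Fin 2]→L[ℝ] ℝ)
    (φ : OpenPartialHomeomorph M (EuclideanSpace ℝ (Fin (2 * n))))
    (y a b : EuclideanSpace ℝ (Fin (2 * n))) :
    formInChart σ φ y ![a, b] = σ (φ.symm y)
      ![mfderiv (𝓡 (2 * n)) (𝓡 (2 * n)) φ.symm y a, mfderiv (𝓡 (2 * n)) (𝓡 (2 * n)) φ.symm y b] := by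
  rw [formInChart]
  refine (ContinuousAlternatingMap.compContinuousLinearMap_apply _ _ _).trans ?_
  congr 1
  ext i : 1
  fin_cases i <;> rfl

theorem formInChart_apply_of_mem_source
    (σ : ∀ q : M, TangentSpace (𝓡 (2 * n)) q [⋀^Fin 2]→L[ℝ] ℝ)
    {φ : OpenPartialHomeomorph M (EuclideanSpace ℝ (Fin (2 * n)))} {q : M} (hq : q ∈ φ.source)
    (a b : EuclideanSpace ℝ (Fin (2 * n))) :
    formInChart σ φ (φ q) ![a, b] = σ q
      (![mfderiv (𝓡 (2 * n)) (𝓡 (2 * n)) φ.symm (φ q) a,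
        mfderiv (𝓡 (2 * n)) (𝓡 (2 * n)) φ.symm (φ q) b] :
        Fin 2 → EuclideanSpace ℝ (Fin (2 * n))) :=
  (formInChart_apply σ φ (φ q) a b).trans (form_congr σ (φ.left_inv hq) _ _)

theorem contDiffOn_transition {φ ψ : OpenPartialHomeomorph M (EuclideanSpace ℝ (Fin (2 * n)))}
    (hφ : φ ∈ IsManifold.maximalAtlas (𝓡 (2 * n)) r M)
    (hψ : ψ ∈ IsManifold.maximalAtlas (𝓡 (2 * n)) r M) :
    ContDiffOn ℝ r (φ.symm.trans ψ) (φ.symm.trans ψ).source := by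
  rw [← contMDiffOn_iff_contDiffOn]
  exact (contMDiffOn_of_mem_maximalAtlas hψ).comp
    ((contMDiffOn_symm_of_mem_maximalAtlas hφ).mono fun x hx => hx.1) fun x hx => hx.2

/-- A curve with values in an affine subspace has its velocity in the direction. -/
theorem HasDerivAt.mem_of_eventually_sub_mem {E : Type*} [NormedAddCommGroup E] [NormedSpace ℝ E]
    [FiniteDimensional ℝ E] {W : Submodule ℝ E} {g : ℝ → E} {g' : E} {t : ℝ}
    (hg : HasDerivAt g g' t) (h : ∀ᶠ s in 𝓝 t, g s - g t ∈ W) : g' ∈ W := by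
  refine W.closed_of_finiteDimensional.mem_of_tendsto (hasDerivAt_iff_tendsto_slope.1 hg) ?_
  filter_upwards [nhdsWithin_le_nhds h] with s hs
  rw [slope_def_module]
  exact W.smul_mem _ hs

/-- A one-dimensional submanifold, in a chart `φ`, is a curve whose velocity spans its tangent
space. -/
theorem exists_isCurveGerm [IsManifold (𝓡 (2 * n)) r M] (hr : 1 ≤ r)
    {φ : OpenPartialHomeomorph M (EuclideanSpace ℝ (Fin (2 * n)))}
    (hφ : φ ∈ IsManifold.maximalAtlas (𝓡 (2 * n)) r M) {S : Set M} {p : M} (hp : p ∈ φ.source)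
    (hS : IsSubmanifoldAt r n 1 S p) :
    ∃ u : EuclideanSpace ℝ (Fin (2 * n)), IsCurveGerm r (setInChart φ S) (φ p) u ∧
      ∀ x ∈ tangentSpaceOf n S p, ∃ a : ℝ,
        x = a • (mfderiv (𝓡 (2 * n)) (𝓡 (2 * n)) φ.symm (φ p) u :
          EuclideanSpace ℝ (Fin (2 * n))) := by
  have hr0 : r ≠ 0 := fun h => by simp [h] at hr
  obtain ⟨ψ, hψ, hpψ, W, hW, hSW⟩ := hS
  obtain ⟨w, hw0, hw⟩ := finrank_eq_one_iff'.1 hW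
  have hWw : ∀ x, x ∈ W ↔ ∃ t : ℝ, x = t • (w : EuclideanSpace ℝ (Fin (2 * n))) := fun x =>
    ⟨fun hx => by
      obtain ⟨t, ht⟩ := hw ⟨x, hx⟩
      exact ⟨t, (congrArg Subtype.val ht).symm⟩, by rintro ⟨t, rfl⟩; exact W.smul_mem t w.2⟩
  set χ := φ.symm.trans ψ with hχ
  have hpφ : φ.symm (φ p) = p := φ.left_inv hp
  have hχp : χ (φ p) = ψ p := by simp [hχ, hpφ]
  have hpχ : φ p ∈ χ.source := by simp [hχ, φ.map_source hp, hpφ, hpψ]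
  have hχs : ContDiffOn ℝ r χ.symm χ.target := contDiffOn_transition hψ hφ
  have hχpt := χ.map_source hpχ
  refine ⟨fderiv ℝ χ.symm (χ (φ p)) w, isCurveGerm_of_chart hr0 χ hχs hpχ
    (fun h => hw0 (Subtype.ext h)) fun z hz => ?_, ?_⟩
  · have hz1 : z ∈ φ.target := hz.1
    have hz2 : φ.symm z ∈ ψ.source := hz.2
    have h1 : z ∈ setInChart φ S ↔ φ.symm z ∈ S := by simp [setInChart, hz1]
    rw [h1, hSW _ hz2, hWw, hχp]
    simp only [sub_eq_iff_eq_add']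
    rfl
  · have : IsManifold (𝓡 (2 * n)) 1 M := IsManifold.of_le hr
    let D : TangentSpace (𝓡 (2 * n)) p :=
      (mfderiv (𝓡 (2 * n)) (𝓡 (2 * n)) φ.symm (φ p) (fderiv ℝ χ.symm (χ (φ p)) w) :
        EuclideanSpace ℝ (Fin (2 * n)))
    intro x hx
    suffices h : tangentSpaceOf n S p ≤ Submodule.span ℝ {D} by
      obtain ⟨a, ha⟩ := Submodule.mem_span_singleton.1 (h hx)
      exact ⟨a, ha.symm⟩
    refine Submodule.span_le.2 ?_
    -- Read in ψ, the curve stays in an affine line, so its velocity is a multiple of `w`; passing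
    -- from ψ to φ and back to the manifold makes it that multiple of `D`.
    rintro _ ⟨γ, hγ0, hγ, hγS, rfl⟩
    refine Submodule.mem_span_singleton.2 ?_
    have hγc : ContinuousAt γ 0 := hγ.continuousAt
    have hγd : MDifferentiableAt 𝓘(ℝ, ℝ) (𝓡 (2 * n)) γ 0 := hγ.mdifferentiableAt one_ne_zero
    have hψd : MDifferentiableAt (𝓡 (2 * n)) (𝓡 (2 * n)) ψ (γ 0) := by
      rw [hγ0]
      exact (contMDiffAt_of_mem_maximalAtlas hψ hpψ).mdifferentiableAt hr0
    set g : ℝ → EuclideanSpace ℝ (Fin (2 * n)) := ψ ∘ γ with hg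
    have hgd : HasDerivAt g (deriv g 0) 0 :=
      (mdifferentiableAt_iff_differentiableAt.1 (hψd.comp 0 hγd)).hasDerivAt
    have hg0 : g 0 = χ (φ p) := by rw [hχp, hg, Function.comp_apply, hγ0]
    have hsrc : ∀ᶠ t in 𝓝 (0 : ℝ), γ t ∈ φ.source ∧ γ t ∈ ψ.source :=
      (hγc.eventually_mem (by rw [hγ0]; exact φ.open_source.mem_nhds hp)).and
        (hγc.eventually_mem (by rw [hγ0]; exact ψ.open_source.mem_nhds hpψ))
    have hgW : deriv g 0 ∈ W := by
      refine hgd.mem_of_eventually_sub_mem ?_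
      filter_upwards [hγS, hsrc] with t ht hts
      rw [hg0, hχp]
      exact (hSW _ hts.2).1 ht
    obtain ⟨k, hk⟩ := (hWw _).1 hgW
    set h : ℝ → EuclideanSpace ℝ (Fin (2 * n)) := χ.symm ∘ g with hh
    have hh0 : h 0 = φ p := by rw [hh, Function.comp_apply, hg0, χ.left_inv hpχ]
    have hhd : HasDerivAt h (fderiv ℝ χ.symm (χ (φ p)) (deriv g 0)) 0 := by
      have h1 := ((hχs.contDiffAt (χ.open_target.mem_nhds hχpt)).differentiableAt
        hr0).hasFDerivAt
      rw [← hg0] at h1 ⊢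
      exact h1.comp_hasDerivAt (0 : ℝ) hgd
    have hγeq : γ =ᶠ[𝓝 0] φ.symm ∘ h := by
      filter_upwards [hsrc] with t ht
      simp [hh, hg, hχ, ψ.left_inv ht.2, φ.left_inv ht.1]
    have hφd : MDifferentiableAt (𝓡 (2 * n)) (𝓡 (2 * n)) φ.symm (φ p) :=
      (contMDiffAt_symm_of_mem_maximalAtlas hφ (φ.map_source hp)).mdifferentiableAt hr0
    have hm := mfderiv_comp_of_eq (I := 𝓘(ℝ, ℝ)) (x := (0 : ℝ)) hφd
      hhd.differentiableAt.mdifferentiableAt hh0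
    have hm2 := hγeq.mfderiv_eq (I := 𝓘(ℝ, ℝ)) (I' := 𝓡 (2 * n))
    let Dφ : EuclideanSpace ℝ (Fin (2 * n)) →
        EuclideanSpace ℝ (Fin (2 * n)) →L[ℝ] EuclideanSpace ℝ (Fin (2 * n)) := fun y =>
      mfderiv (𝓡 (2 * n)) (𝓡 (2 * n)) φ.symm y
    have h1 : (mfderiv 𝓘(ℝ, ℝ) (𝓡 (2 * n)) γ 0 (1 : ℝ) : EuclideanSpace ℝ (Fin (2 * n))) =
        Dφ (φ p) (deriv h 0) := by
      have h2 := congrArg (fun L : ℝ →L[ℝ] EuclideanSpace ℝ (Fin (2 * n)) => L 1) (hm2.trans hm)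
      refine h2.trans ?_
      have h3 : (mfderiv 𝓘(ℝ, ℝ) (𝓡 (2 * n)) h 0 : ℝ →L[ℝ] EuclideanSpace ℝ (Fin (2 * n))) =
          fderiv ℝ h 0 := mfderiv_eq_fderiv
      change Dφ (h 0) ((mfderiv 𝓘(ℝ, ℝ) (𝓡 (2 * n)) h 0 :
        ℝ →L[ℝ] EuclideanSpace ℝ (Fin (2 * n))) 1) = _
      rw [h3, hh0]
      rfl
    rw [hhd.deriv, hk, map_smul, map_smul] at h1
    exact ⟨k, h1.symm⟩

/-- Both tangent spaces lie in the lines spanned by the velocities a and b. If σ(a, b) = 0, the form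
restricts to zero on their sum, contradicting rank 2. Only these inclusions are needed, since they
suffice to bound the rank from above. -/
theorem exists_isSymplecticCross [IsManifold (𝓡 (2 * n)) r M] (hr : 1 ≤ r)
    (σ : SymplecticForm r n M) {S₁ S₂ : Set M} {p : M} (h₁ : IsSubmanifoldAt r n 1 S₁ p)
    (h₂ : IsSubmanifoldAt r n 1 S₂ p) (hG3 : CondG3 σ 1 S₁ S₂ p) :
    ∃ u v, IsSymplecticCross r (chartAt (EuclideanSpace ℝ (Fin (2 * n))) p).target
      (formInChart σ.form (chartAt _ p)) (setInChart (chartAt _ p) S₁)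
      (setInChart (chartAt _ p) S₂) (chartAt _ p p) u v := by
  set φ := chartAt (EuclideanSpace ℝ (Fin (2 * n))) p with hφdef
  have hφ : φ ∈ atlas (EuclideanSpace ℝ (Fin (2 * n))) M := chart_mem_atlas _ p
  have hφm : φ ∈ IsManifold.maximalAtlas (𝓡 (2 * n)) r M := IsManifold.chart_mem_maximalAtlas p
  have hp : p ∈ φ.source := mem_chart_source _ p
  have : IsManifold (𝓡 (2 * n)) 1 M := IsManifold.of_le hr
  -- A line in a space of dimension 2n forces n ≥ 1, which selects the first clause of `CondG3`.
  have hn : 1 ≤ n := by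
    obtain ⟨-, -, -, W, hW, -⟩ := h₁
    have h := W.finrank_le
    rw [hW, finrank_euclideanSpace_fin] at h
    omega
  obtain ⟨u, hu, hTu⟩ := exists_isCurveGerm hr hφm hp h₁
  obtain ⟨v, hv, hTv⟩ := exists_isCurveGerm hr hφm hp h₂
  have hφd : φ.MDifferentiable (𝓡 (2 * n)) (𝓡 (2 * n)) := mdifferentiable_of_mem_atlas hφ
  refine ⟨u, v, φ.open_target, φ.map_source hp, σ.contDiffOn φ hφ, σ.closed φ hφ, fun x hx => ?_,
    hu, hv, fun h0 => ?_⟩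
  · have hinj := hφd.symm.mfderiv_injective (φ.map_source hp)
    have hsurj := hφd.symm.mfderiv_surjective (φ.map_source hp)
    refine hinj (Eq.trans ?_ (map_zero _).symm)
    refine σ.nondegenerate _ _ fun w => ?_
    obtain ⟨z, rfl⟩ := hsurj w
    rw [← hx z]
    exact (formInChart_apply σ.form φ (φ p) x z).symm
  · rw [formInChart_apply_of_mem_source _ hp] at h0
    set a : TangentSpace (𝓡 (2 * n)) p := mfderiv (𝓡 (2 * n)) (𝓡 (2 * n)) φ.symm (φ p) u
    set b : TangentSpace (𝓡 (2 * n)) p := mfderiv (𝓡 (2 * n)) (𝓡 (2 * n)) φ.symm (φ p) v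
    have h2 := hG3.1 hn
    have hzero : (bilinOfForm (σ.form p)).restrict
        (tangentSpaceOf n S₁ p ⊔ tangentSpaceOf n S₂ p) = 0 := by
      have hab : bilinOfForm (σ.form p) a b = 0 := h0
      have hself : ∀ x, bilinOfForm (σ.form p) x x = 0 := fun x =>
        (σ.form p).map_eq_zero_of_eq ![x, x] (i := 0) (j := 1) rfl (by decide)
      have hba : bilinOfForm (σ.form p) b a = 0 := by
        have h := hself (a + b)
        simp only [map_add, LinearMap.add_apply, hself, hab] at h
        linarith
      have hmem : ∀ x ∈ tangentSpaceOf n S₁ p ⊔ tangentSpaceOf n S₂ p,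
          ∃ s t : ℝ, x = s • a + t • b := fun x hx => by
        obtain ⟨y, hy, z, hz, rfl⟩ := Submodule.mem_sup.1 hx
        obtain ⟨s, rfl⟩ := hTu y hy
        obtain ⟨t, rfl⟩ := hTv z hz
        exact ⟨s, t, rfl⟩
      ext x y
      obtain ⟨s, t, hx⟩ := hmem x x.2
      obtain ⟨s', t', hy⟩ := hmem y y.2
      change bilinOfForm (σ.form p) x y = 0
      rw [hx, hy]
      simp only [map_add, map_smul, LinearMap.add_apply, LinearMap.smul_apply, hself, hab, hba,
        smul_zero, add_zero]
    rw [rankOn, hzero, LinearMap.range_zero, finrank_bot] at h2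
    omega

end Charts

/-! ### Return to the manifolds and conclusion -/

/-- Local equivalences of manifolds assembled from local equivalences of their chart domains. -/
theorem germEquivalent_of_chart {r : WithTop ℕ∞} (hr : 1 ≤ r) {n : ℕ}
    {M : Type*} [TopologicalSpace M] [ChartedSpace (EuclideanSpace ℝ (Fin (2 * n))) M]
    [IsManifold (𝓡 (2 * n)) r M]
    {M' : Type*} [TopologicalSpace M'] [ChartedSpace (EuclideanSpace ℝ (Fin (2 * n))) M']
    [IsManifold (𝓡 (2 * n)) r M']
    (σ : SymplecticForm r n M) (N : Set M) (p : M) (σ' : SymplecticForm r n M') (N' : Set M')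
    (p' : M') {φ : OpenPartialHomeomorph M (EuclideanSpace ℝ (Fin (2 * n)))}
    (hφ : φ ∈ IsManifold.maximalAtlas (𝓡 (2 * n)) r M) (hp : p ∈ φ.source)
    {φ' : OpenPartialHomeomorph M' (EuclideanSpace ℝ (Fin (2 * n)))}
    (hφ' : φ' ∈ IsManifold.maximalAtlas (𝓡 (2 * n)) r M') (hp' : p' ∈ φ'.source)
    (f : OpenPartialHomeomorph (EuclideanSpace ℝ (Fin (2 * n))) (EuclideanSpace ℝ (Fin (2 * n))))
    (hpf : φ p ∈ f.source) (hfp : f (φ p) = φ' p') (hft : f.target ⊆ φ'.target)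
    (hf : ContDiffOn ℝ r f f.source) (hfs : ContDiffOn ℝ r f.symm f.target)
    (hpull : ∀ x ∈ f.source,
      pullbackForm (formInChart σ'.form φ') f x = formInChart σ.form φ x)
    (hN : ∀ x ∈ f.source, f x ∈ setInChart φ' N' ↔ x ∈ setInChart φ N) :
    GermEquivalent σ N p σ' N' p' := by
  have hr0 : r ≠ 0 := fun h => by simp [h] at hr
  set Φ := φ.trans (f.trans φ'.symm) with hΦ
  have hΦcoe : (Φ : M → M') = φ'.symm ∘ f ∘ φ := rfl
  have hΦsymm : (Φ.symm : M' → M) = φ.symm ∘ f.symm ∘ φ' := rfl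
  have hsrc : ∀ q ∈ Φ.source, q ∈ φ.source ∧ φ q ∈ f.source ∧ f (φ q) ∈ φ'.target := fun q hq =>
    ⟨hq.1, hq.2.1, hq.2.2⟩
  have htgt : ∀ q ∈ Φ.target, q ∈ φ'.source ∧ φ' q ∈ f.target ∧ f.symm (φ' q) ∈ φ.target :=
    fun q hq => ⟨hq.1.1, hq.1.2, hq.2⟩
  have hNΦ : ∀ q ∈ Φ.source, Φ q ∈ N' ↔ q ∈ N := fun q hq => by
    obtain ⟨h1, h2, h3⟩ := hsrc q hq
    rw [← mem_setInChart_iff h1, ← hN _ h2]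
    simp [setInChart, h3, hΦcoe]
  have cφ := contMDiffOn_of_mem_maximalAtlas hφ
  have cφs := contMDiffOn_symm_of_mem_maximalAtlas hφ
  have cφ' := contMDiffOn_of_mem_maximalAtlas hφ'
  have cφs' := contMDiffOn_symm_of_mem_maximalAtlas hφ'
  refine ⟨Φ, ?_, ?_, ⟨hp, hpf, hft (f.map_source hpf)⟩, ?_, fun q hq => ?_, ?_⟩
  · rw [hΦcoe]
    exact cφs'.comp (hf.contMDiffOn.comp (cφ.mono fun q hq => (hsrc q hq).1)
      fun q hq => (hsrc q hq).2.1) fun q hq => (hsrc q hq).2.2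
  · rw [hΦsymm]
    exact cφs.comp (hfs.contMDiffOn.comp (cφ'.mono fun q hq => (htgt q hq).1)
      fun q hq => (htgt q hq).2.1) fun q hq => (htgt q hq).2.2
  · rw [hΦcoe, Function.comp_apply, Function.comp_apply, hfp, φ'.left_inv hp']
  · obtain ⟨h1, h2, h3⟩ := hsrc q hq
    have dφ : MDifferentiableAt (𝓡 (2 * n)) (𝓡 (2 * n)) φ q :=
      (contMDiffAt_of_mem_maximalAtlas hφ h1).mdifferentiableAt hr0
    have dφs : MDifferentiableAt (𝓡 (2 * n)) (𝓡 (2 * n)) φ.symm (φ q) :=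
      (contMDiffAt_symm_of_mem_maximalAtlas hφ (φ.map_source h1)).mdifferentiableAt hr0
    have df : MDifferentiableAt (𝓡 (2 * n)) (𝓡 (2 * n)) f (φ q) :=
      ((hf.contDiffAt (f.open_source.mem_nhds h2)).differentiableAt hr0).mdifferentiableAt
    have dφs' : MDifferentiableAt (𝓡 (2 * n)) (𝓡 (2 * n)) φ'.symm (f (φ q)) :=
      (contMDiffAt_symm_of_mem_maximalAtlas hφ' h3).mdifferentiableAt hr0
    -- The differentials are typed on the model space so that they compose without transport between
    -- tangent spaces at equal points.
    let A : EuclideanSpace ℝ (Fin (2 * n)) →L[ℝ] EuclideanSpace ℝ (Fin (2 * n)) :=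
      mfderiv (𝓡 (2 * n)) (𝓡 (2 * n)) φ q
    let B : EuclideanSpace ℝ (Fin (2 * n)) →L[ℝ] EuclideanSpace ℝ (Fin (2 * n)) :=
      mfderiv (𝓡 (2 * n)) (𝓡 (2 * n)) φ.symm (φ q)
    let C : EuclideanSpace ℝ (Fin (2 * n)) →L[ℝ] EuclideanSpace ℝ (Fin (2 * n)) :=
      mfderiv (𝓡 (2 * n)) (𝓡 (2 * n)) φ'.symm (f (φ q))
    let D : EuclideanSpace ℝ (Fin (2 * n)) →L[ℝ] EuclideanSpace ℝ (Fin (2 * n)) :=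
      mfderiv (𝓡 (2 * n)) (𝓡 (2 * n)) Φ q
    have hD : D = C.comp ((fderiv ℝ f (φ q)).comp A) := by
      have h4 := mfderiv_comp q df dφ
      have h5 := mfderiv_comp (I := 𝓡 (2 * n)) (f := f ∘ φ) q dφs' (df.comp q dφ)
      refine h5.trans ?_
      rw [h4, mfderiv_eq_fderiv]
      rfl
    have hBA : B.comp A = ContinuousLinearMap.id ℝ _ := by
      have h4 := mfderiv_comp q dφs dφ
      have h5 : φ.symm ∘ φ =ᶠ[𝓝 q] id := by
        filter_upwards [φ.open_source.mem_nhds h1] with z hz using φ.left_inv hz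
      exact h4.symm.trans (h5.mfderiv_eq.trans (mfderiv_id (I := 𝓡 (2 * n))))
    have key : ∀ a b : EuclideanSpace ℝ (Fin (2 * n)),
        σ'.form (Φ q) (![D a, D b] : Fin 2 → EuclideanSpace ℝ (Fin (2 * n))) =
          σ.form q (![a, b] : Fin 2 → EuclideanSpace ℝ (Fin (2 * n))) := by
      intro a b
      have h4 := congrArg (fun s => formToBilin _ s (A a) (A b)) (hpull _ h2)
      simp only [formToBilin_pullbackForm] at h4
      rw [formToBilin_apply, formToBilin_apply, formInChart_apply_of_mem_source σ.form h1] at h4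
      have h5 := formInChart_apply σ'.form φ' (f (φ q)) (fderiv ℝ f (φ q) (A a))
        (fderiv ℝ f (φ q) (A b))
      rw [hD]
      refine (h5.symm.trans h4).trans ?_
      have h6 : ∀ x, B (A x) = x := fun x =>
        congrArg (fun L : EuclideanSpace ℝ (Fin (2 * n)) →L[ℝ] EuclideanSpace ℝ (Fin (2 * n)) =>
          L x) hBA
      change σ.form q (![B (A a), B (A b)] : Fin 2 → EuclideanSpace ℝ (Fin (2 * n))) = _
      rw [h6, h6]
    ext w
    refine (ContinuousAlternatingMap.compContinuousLinearMap_apply _ _ _).trans ?_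
    have e1 : (fun i => D (w i) : Fin 2 → EuclideanSpace ℝ (Fin (2 * n))) =
        ![D (w 0), D (w 1)] := funext fun i => by fin_cases i <;> rfl
    have e2 : (w : Fin 2 → EuclideanSpace ℝ (Fin (2 * n))) = ![w 0, w 1] :=
      funext fun i => by fin_cases i <;> rfl
    exact (congrArg (σ'.form (Φ q)) e1).trans
      ((key (w 0) (w 1)).trans (congrArg (σ.form q) e2.symm))
  · ext z
    constructor
    · rintro ⟨q, ⟨hqN, hq⟩, rfl⟩
      exact ⟨(hNΦ q hq).2 hqN, Φ.map_source hq⟩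
    · rintro ⟨hzN, hz⟩
      have h1 := Φ.map_target hz
      refine ⟨Φ.symm z, ⟨(hNΦ _ h1).1 ?_, h1⟩, Φ.right_inv hz⟩
      rwa [Φ.right_inv hz]

theorem theoremA1 (r : WithTop ℕ∞) (hr : r = ∞ ∨ r = ω) (n : ℕ)
    {M : Type*} [TopologicalSpace M] [ChartedSpace (EuclideanSpace ℝ (Fin (2 * n))) M]
    [IsManifold (𝓡 (2 * n)) r M]
    {M' : Type*} [TopologicalSpace M'] [ChartedSpace (EuclideanSpace ℝ (Fin (2 * n))) M']
    [IsManifold (𝓡 (2 * n)) r M']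
    (σ : SymplecticForm r n M) (S₁ S₂ : Set M) (p : M)
    (hS₁ : IsSubmanifoldAt r n 1 S₁ p) (hS₂ : IsSubmanifoldAt r n 1 S₂ p)
    (hG2 : CondG2 n 1 S₁ S₂ p) (hG3 : CondG3 σ 1 S₁ S₂ p)
    (σ' : SymplecticForm r n M') (S₁' S₂' : Set M') (p' : M')
    (hS₁' : IsSubmanifoldAt r n 1 S₁' p') (hS₂' : IsSubmanifoldAt r n 1 S₂' p')
    (hG2' : CondG2 n 1 S₁' S₂' p') (hG3' : CondG3 σ' 1 S₁' S₂' p') :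
    GermEquivalent σ (S₁ ∪ S₂) p σ' (S₁' ∪ S₂') p' := by
  have hr1 : (1 : WithTop ℕ∞) ≤ r := by rcases hr with rfl | rfl <;> simp
  obtain ⟨u, v, h⟩ := exists_isSymplecticCross hr1 σ hS₁ hS₂ hG3
  obtain ⟨u', v', h'⟩ := exists_isSymplecticCross hr1 σ' hS₁' hS₂' hG3'
  obtain ⟨f, hpf, hfp, -, hft, hf, hfs, hpull, hN⟩ := h.exists_equivalence hr h'
  refine germEquivalent_of_chart hr1 σ _ p σ' _ p' (IsManifold.chart_mem_maximalAtlas p)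
    (mem_chart_source _ p) (IsManifold.chart_mem_maximalAtlas p') (mem_chart_source _ p') f hpf hfp
    hft hf hfs hpull fun x hx => ?_
  rw [setInChart_union, setInChart_union]
  exact hN x hx
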